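/- Let $\lambda>1$ and $\Omega>0$, and consider the undisturbed scalar plant $$X_{t+1}=\lambda X_t+U_t,\qquad t\ge 0,\qquad |X_0|\le \tfrac{\Omega}{2}.$$ The plant is controlled over a discrete memoryless channel (DMC) with finite input alphabet $\mathcal A$, finite output alphabet $\mathcal B$ and transition probabilities $p(b\mid a)$. At each time $t$ a time-varying observer, which sees the states $X_0,\dots,X_t$ exactly (and neither the channel outputs nor, except through the states, the controls), chooses the channel input $a_t$; the channel produces $B_t\sim p(\cdot\mid a_t)$; and a time-varying controller, which sees $B_0,\dots,B_t$, chooses $U_t$. Observer and controller may also use common randomness, which is independent of the channel. Suppose that the Shannon capacity $C=\sup_Q I(A;B)$ of the channel, in bits per channel use (the supremum is over input distributions $Q$ on $\mathcal A$), satisfies $C>\log_2\lambda$. Then there is an observer/controller pair such that, for every initial condition with $|X_0|\le\Omega/2$, $$\lim_{t\to\infty}X_t=0\quad\text{almost surely},$$ where the probability is over the channel and the common randomness. Furthermore, a capacity-achieving input distribution exists, and for every capacity-achieving $Q$ there are $n\ge1$, $\Delta_0>0$ and $\rho\in(0,1)$ such that, with $\Delta_t=\Delta_0\rho^t$, this is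 achieved, together with a suitable controller, by the following observer. At each time $t=kn$, $k=0,1,2,\dots$, it computes the index $j\in\mathbb Z$ with $$X_{kn}\in\bigl(\Delta_{kn}(\tfrac j2+\tfrac14),\ \Delta_{kn}(\tfrac j2+\tfrac34)\bigr]$$ of the bin to which the $\Delta_{kn}$-lattice based quantizer assigns $X_{kn}$, and sends the random label $A_{k,j}\in\mathcal A^n$ of this bin over the channel, letter by letter, during the times $kn,\dots,kn+n-1$. The labels $A_{k,j}$ ($k\ge0$, $j\in\mathbb Z$) are drawn iid from $\mathcal A^n$ with the product distribution $Q^{\otimes n}$. They form the common randomness, to which the controller has access. -/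

import Mathlib

universe u v

open MeasureTheory Filter Topology

noncomputable section

namespace NoisyControl

/-! ### Discrete memoryless channels and their Shannon capacity -/

/-- A discrete memoryless channel: `P a b` is the probability `p(b | a)` of the output `b` when the
input is `a`. -/
abbrev DMC (A : Type u) (B : Type v) := A → PMF B

/-- The mutual information `I(A;B)`, in bits, between an input with distribution `Q` and the
corresponding output of the channel `P` (whose distribution is `Q.bind P`). -/
def mutualInformation {A : Type u} {B : Type v} [Fintype A] [Fintype B]
    (P : DMC A B) (Q : PMF A) : ℝ :=
  ∑ a, ∑ b, (Q a).toReal * (P a b).toReal *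
    Real.logb 2 ((P a b).toReal / (Q.bind P b).toReal)

/-- The Shannon capacity of a DMC, in bits per channel use. -/
def capacity {A : Type u} {B : Type v} [Fintype A] [Fintype B] (P : DMC A B) : ℝ :=
  ⨆ Q : PMF A, mutualInformation P Q

/-- `Q` is a capacity-achieving input distribution for the channel `P`. -/
def IsCapacityAchieving {A : Type u} {B : Type v} [Fintype A] [Fintype B]
    (P : DMC A B) (Q : PMF A) : Prop :=
  mutualInformation P Q = capacity P

/-- The randomness of a DMC over time.  At each time `t` a fresh random map `v t : A → B` is drawn,
independently of everything else, with `v t a` distributed as `P a`; the channel with input `a`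
at time `t` outputs `v t a`.  So, given the input at time `t`, the output at time `t` has
distribution `p(· | a)` and is independent of the past. -/
def channelLaw {A : Type u} {B : Type v} [Fintype A] [MeasurableSpace B] (P : DMC A B) :
    Measure (ℕ → A → B) :=
  Measure.infinitePi fun _ : ℕ => Measure.pi fun a => (P a).toMeasure

/-! ### The closed loop -/

/-- A time-varying observer/controller pair with common randomness `R`.  At time `t` the observer
sees the common randomness and the states `X_0, …, X_t` (nothing else), and chooses a
channel input; the controller sees the common randomness and the channel outputs
`B_0, …, B_t`, and chooses the control. -/
structure Scheme (A : Type u) (B : Type v) (R : Type u)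
    [MeasurableSpace A] [MeasurableSpace B] [MeasurableSpace R] where
  observer : (t : ℕ) → R → (Fin (t + 1) → ℝ) → A
  controller : (t : ℕ) → R → (Fin (t + 1) → B) → ℝ
  measurable_observer : ∀ t,
    Measurable fun p : R × (Fin (t + 1) → ℝ) => observer t p.1 p.2
  measurable_controller : ∀ t,
    Measurable fun p : R × (Fin (t + 1) → B) => controller t p.1 p.2

namespace Scheme

variable {A : Type u} {B : Type v} {R : Type u}
  [MeasurableSpace A] [MeasurableSpace B] [MeasurableSpace R]

/-- The closed-loop history `((X_0, …, X_t), (B_0, …, B_{t-1}))` for the plant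
`X_{t+1} = lam * X_t + U_t + w t`, `X_0 = x0`, with common randomness `r` and channel maps `v`. -/
def history (S : Scheme A B R) (lam : ℝ) (w : ℕ → ℝ) (x0 : ℝ) (r : R) (v : ℕ → A → B) :
    (t : ℕ) → (Fin (t + 1) → ℝ) × (Fin t → B)
  | 0 => (fun _ => x0, Fin.elim0)
  | t + 1 =>
    let h := history S lam w x0 r v t
    let b : Fin (t + 1) → B := Fin.snoc (α := fun _ => B) h.2 (v t (S.observer t r h.1))
    (Fin.snoc (α := fun _ => ℝ) h.1 (lam * h.1 (Fin.last t) + S.controller t r b + w t), b)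

/-- The plant state `X_t` of the closed loop. -/
def state (S : Scheme A B R) (lam : ℝ) (w : ℕ → ℝ) (x0 : ℝ) (r : R) (v : ℕ → A → B)
    (t : ℕ) : ℝ :=
  (S.history lam w x0 r v t).1 (Fin.last t)

/-- The channel output `B_t` of the closed loop. -/
def output (S : Scheme A B R) (lam : ℝ) (w : ℕ → ℝ) (x0 : ℝ) (r : R) (v : ℕ → A → B)
    (t : ℕ) : B :=
  (S.history lam w x0 r v (t + 1)).2 (Fin.last t)

/-- `S` drives the undisturbed plant (`w = 0`) to zero almost surely from every initial
condition with `|x0| ≤ Om / 2`, when the common randomness has law `ν` and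
is independent of the channel. -/
def StabilizesAlmostSurely [Fintype A] (S : Scheme A B R) (ν : Measure R) (P : DMC A B)
    (lam Om : ℝ) : Prop :=
  ∀ x0 : ℝ, |x0| ≤ Om / 2 →
    ∀ᵐ p ∂(ν.prod (channelLaw P)),
      Tendsto (fun t => S.state lam (fun _ => 0) x0 p.1 p.2 t) atTop (𝓝 0)

variable (S : Scheme A B R) (lam : ℝ) (w : ℕ → ℝ) (x0 : ℝ) (r : R) (v : ℕ → A → B)

theorem history_fst (t : ℕ) :
    (S.history lam w x0 r v t).1 = fun i => S.state lam w x0 r v i.val := by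
  induction t with
  | zero => funext i; fin_cases i; rfl
  | succ t ih =>
    funext i
    refine Fin.lastCases ?_ (fun j => ?_) i
    · rfl
    · have h := congrFun ih j
      simpa [history] using h

theorem history_snd (t : ℕ) :
    (S.history lam w x0 r v t).2 = fun i => S.output lam w x0 r v i.val := by
  induction t with
  | zero => funext i; exact i.elim0
  | succ t ih =>
    funext i
    refine Fin.lastCases ?_ (fun j => ?_) i
    · rfl
    · have h := congrFun ih j
      simpa [history] using h

theorem state_zero : S.state lam w x0 r v 0 = x0 := rfl

theorem output_eq (t : ℕ) :
    S.output lam w x0 r v t =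
      v t (S.observer t r fun i : Fin (t + 1) => S.state lam w x0 r v i) := by
  rw [← history_fst]
  simp [output, history]

theorem state_succ (t : ℕ) :
    S.state lam w x0 r v (t + 1) = lam * S.state lam w x0 r v t +
      S.controller t r (fun i : Fin (t + 1) => S.output lam w x0 r v i) + w t := by
  rw [← history_snd]
  simp [state, history]

end Scheme

/-! ### Randomly-labeled lattice quantizers -/

/-- The `Δ`-lattice based quantizer: the index of the bin to which `x` is assigned. -/
def latticeBin (Δ x : ℝ) : ℤ := ⌈2 * x / Δ - 1 / 2⌉ - 1

theorem latticeBin_eq_iff {Δ : ℝ} (hΔ : 0 < Δ) (x : ℝ) (j : ℤ) :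
    latticeBin Δ x = j ↔
      x ∈ Set.Ioc (Δ * ((j : ℝ) / 2 + 1 / 4)) (Δ * ((j : ℝ) / 2 + 3 / 4)) := by
  have h : latticeBin Δ x = j ↔ ⌈2 * x / Δ - 1 / 2⌉ = j + 1 := by
    unfold latticeBin; omega
  rw [h, Int.ceil_eq_iff, Set.mem_Ioc]
  push_cast
  have e : 2 * x / Δ * Δ = 2 * x := div_mul_cancel₀ _ hΔ.ne'
  constructor
  · rintro ⟨h1, h2⟩
    constructor <;> nlinarith
  · rintro ⟨h1, h2⟩
    constructor
    · have : (j : ℝ) + 1 / 2 < 2 * x / Δ := by rw [lt_div_iff₀ hΔ]; nlinarith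
      linarith
    · have : 2 * x / Δ ≤ (j : ℝ) + 3 / 2 := by rw [div_le_iff₀ hΔ]; nlinarith
      linarith

/-- Labels in `A^n`: `l k j` is the label of bin `j` at the `k`-th sampling time. -/
abbrev Labels (A : Type u) (n : ℕ) := ℕ → ℤ → Fin n → A

/-- The labels are drawn iid, across sampling times and bins, from `A^n`; the `n` letters of
a label are iid with distribution `Q`. -/
def labelLaw {A : Type u} [MeasurableSpace A] (Q : PMF A) (n : ℕ) : Measure (Labels A n) :=
  Measure.infinitePi fun _ : ℕ => Measure.infinitePi fun _ : ℤ =>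
    Measure.pi fun _ : Fin n => Q.toMeasure

/-- The observer that samples the state every `n` time steps, at the times `k * n`, applies the
`Δ (k * n)`-lattice based quantizer to it, and sends the label of the bin
over the channel during the times `k * n, …, k * n + n - 1`. -/
def latticeObserver {A : Type u} (n : ℕ) (hn : 0 < n) (Δ : ℕ → ℝ) (t : ℕ) (l : Labels A n)
    (x : Fin (t + 1) → ℝ) : A :=
  l (t / n)
    (latticeBin (Δ (t / n * n)) (x ⟨t / n * n, Nat.lt_succ_of_le (Nat.div_mul_le_self t n)⟩))
    ⟨t % n, Nat.mod_lt t hn⟩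

end NoisyControl

end

open NoisyControl

/-!
The block length is `n = 1` and `Δ_t = 2 ρ ^ t`, where `lam / ρ = μ` is chosen between `lam` and
`2 ^ I(A;B)`. The controller only applies controls that keep the state of the form
`X_t = lam ^ t * X_0 - ρ ^ t * s_t` with an integer `s_t`. Since `Δ_t / 2 = ρ ^ t` is the width of
the bins, the bin of `X_t` is then the cell of `X_0` in a *fixed* partition of the line into cells
of width `μ ^ (-t)`, shifted by `s_t` (`latticeBin_eq_cell_sub`). The controller knows the shift, so
it can compute the letters that any hypothetical initial condition `x` would have sent. At time `K`
it looks for an `x` that passes a likelihood-ratio test, with threshold `G` per letter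
(`μ < G < 2 ^ I(A;B)`), on every final window `[K - d, K)` of length `d ≥ K / q`, and lets `s_K` be
the cell of this `x`.

The labels of time `t` are independent of everything before time `t`, in particular of the shift
`s_t`. Hence products of per-letter weights along the closed loop behave like products of
independent factors (`lintegral_prod_Ico_le`, which rests on the resampling identity
`lintegral_prod_infinitePi_update`). Two consequences for a window of length `d`:

* The true initial condition fails with probability at most `θ ^ d`, `θ < 1`, by a Chernoff bound
  (`exists_chernoffWeight_mean_lt_one`, `measure_loopScore_true_lt`).
* An `x` at distance at least `μ ^ (-j)`, `j = K - d`, lies in other cells than `X_0` from time `j`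
  on, so that its letters are independent of the channel outputs. It passes with probability at
  most `G ^ (-d)` (`measure_loopScore_false_ge`). If its distance is also at most of the order of
  `μ ^ (-j)`, its cells on the window are one of `O(d μ ^ d)` sequences, because the sum of the cell
  indices, being a sum of monotone functions of `x`, determines all of them (`cell_eq_of_sum_eq`,
  `card_sum_cell_le`). So the union bound costs `O(d (μ / G) ^ d)` (`measure_exists_false_le`).

By Borel-Cantelli, almost surely there are finally no errors (`ae_eventually_no_windowError`). Then
the accepted `x` is within about `μ ^ (K / q - K)` of `X_0`, and `X_K` is of the order of
`ρ ^ K * μ ^ (K / q)` (`abs_state_le_of_no_windowError`), which tends to `0` if `q` is so large that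
`ρ ^ q * μ < 1`.

A capacity-achieving input distribution exists because mutual information is continuous on the
compact simplex (`mutualInformation_eq_entropy_sub`, `exists_mutualInformation_max`).
-/


namespace NoisyControl

/-! ### Mutual information and likelihood ratios -/

section InformationTheory

variable {A : Type u} {B : Type v} [Fintype A]

theorem toReal_bind_apply (P : DMC A B) (Q : PMF A) (b : B) :
    (Q.bind P b).toReal = ∑ a, (Q a).toReal * (P a b).toReal := by
  rw [PMF.bind_apply, tsum_fintype, ENNReal.toReal_sum]
  · simp [ENNReal.toReal_mul]
  · intro a _
    exact ENNReal.mul_ne_top (PMF.apply_ne_top _ _) (PMF.apply_ne_top _ _)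

/-- An output that is reachable from an input of positive probability has positive probability. -/
theorem toReal_bind_pos (P : DMC A B) (Q : PMF A) {a : A} {b : B}
    (h : (Q a).toReal * (P a b).toReal ≠ 0) : 0 < (Q.bind P b).toReal := by
  rw [toReal_bind_apply]
  refine lt_of_lt_of_le (lt_of_le_of_ne (by positivity) h.symm)
    (Finset.single_le_sum (f := fun a => (Q a).toReal * (P a b).toReal)
      (fun i _ => by positivity) (Finset.mem_univ a))

theorem sum_toReal_pmf (Q : PMF A) : ∑ a, (Q a).toReal = 1 := by
  rw [← ENNReal.toReal_sum (fun a _ => PMF.apply_ne_top _ _), ← tsum_fintype (L := .unconditional _),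
    PMF.tsum_coe, ENNReal.toReal_one]

/-- `I(A;B) = H(B) - H(B | A)`; in this form mutual information is visibly continuous in `Q`. -/
theorem mutualInformation_eq_entropy_sub [Fintype B] (P : DMC A B) (Q : PMF A) :
    mutualInformation P Q =
      (∑ b, Real.negMulLog (∑ a, (Q a).toReal * (P a b).toReal) -
        ∑ a, (Q a).toReal * ∑ b, Real.negMulLog (P a b).toReal) / Real.log 2 := by
  have key : ∀ a b, (Q a).toReal * (P a b).toReal *
      Real.logb 2 ((P a b).toReal / (Q.bind P b).toReal) =
      (-((Q a).toReal * (P a b).toReal * Real.log (∑ a, (Q a).toReal * (P a b).toReal)) -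
        (Q a).toReal * Real.negMulLog (P a b).toReal) / Real.log 2 := by
    intro a b
    by_cases h : (Q a).toReal * (P a b).toReal = 0
    · have h' : (Q a).toReal * Real.negMulLog (P a b).toReal = 0 := by
        rw [Real.negMulLog, neg_mul, mul_neg, ← mul_assoc, h]; simp
      rw [h, h']; simp
    · have hq := toReal_bind_pos P Q h
      have hp : (P a b).toReal ≠ 0 := right_ne_zero_of_mul h
      rw [Real.logb, Real.log_div hp hq.ne', toReal_bind_apply, Real.negMulLog]
      ring
  unfold mutualInformation
  simp_rw [key, ← Finset.sum_div, Finset.sum_sub_distrib]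
  congr 2
  · rw [Finset.sum_comm]
    refine Finset.sum_congr rfl fun b _ => ?_
    rw [Finset.sum_neg_distrib, ← Finset.sum_mul, Real.negMulLog, neg_mul]
  · simp_rw [Finset.mul_sum]

theorem exists_mutualInformation_max [Nonempty A] [Fintype B] (P : DMC A B) :
    ∃ Q : PMF A, ∀ Q' : PMF A, mutualInformation P Q' ≤ mutualInformation P Q := by
  classical
  let F : (A → ℝ) → ℝ := fun x =>
    (∑ b, Real.negMulLog (∑ a, x a * (P a b).toReal) -
        ∑ a, x a * ∑ b, Real.negMulLog (P a b).toReal) / Real.log 2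
  have hF : Continuous F := by
    have := Real.continuous_negMulLog
    fun_prop
  have hne : (stdSimplex ℝ A).Nonempty := ⟨_, single_mem_stdSimplex ℝ (Classical.arbitrary A)⟩
  obtain ⟨x, hx, hmax⟩ := (isCompact_stdSimplex ℝ A).exists_isMaxOn hne hF.continuousOn
  let Q : PMF A := PMF.ofFintype (fun a => ENNReal.ofReal (x a)) (by
    rw [← ENNReal.ofReal_sum_of_nonneg (fun a _ => hx.1 a), hx.2, ENNReal.ofReal_one])
  have hQ : ∀ a, (Q a).toReal = x a := fun a => by
    simp [Q, PMF.ofFintype_apply, ENNReal.toReal_ofReal (hx.1 a)]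
  refine ⟨Q, fun Q' => ?_⟩
  have := hmax (show (fun a => (Q' a).toReal) ∈ stdSimplex ℝ A from
    ⟨fun a => ENNReal.toReal_nonneg, sum_toReal_pmf Q'⟩)
  rw [mutualInformation_eq_entropy_sub, mutualInformation_eq_entropy_sub]
  simp_rw [hQ]
  exact this

theorem exists_isCapacityAchieving [Nonempty A] [Fintype B] (P : DMC A B) :
    ∃ Q : PMF A, IsCapacityAchieving P Q := by
  obtain ⟨Q, hQ⟩ := exists_mutualInformation_max P
  have : Nonempty (PMF A) := ⟨Q⟩
  exact ⟨Q, le_antisymm (le_ciSup (f := mutualInformation P)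
    ⟨_, Set.forall_mem_range.2 hQ⟩ Q) (ciSup_le hQ)⟩

/-- The ratio `p(b | a) / q(b)`, where `q` is the output distribution for the input
distribution `Q`.  Its logarithm is the information density; it is `0` if `q(b) = 0`. -/
noncomputable def likelihoodRatio (P : DMC A B) (Q : PMF A) (a : A) (b : B) : ℝ :=
  (P a b).toReal / (Q.bind P b).toReal

omit [Fintype A] in
theorem likelihoodRatio_nonneg (P : DMC A B) (Q : PMF A) (a : A) (b : B) :
    0 ≤ likelihoodRatio P Q a b := by unfold likelihoodRatio; positivity

theorem likelihoodRatio_pos (P : DMC A B) (Q : PMF A) {a : A} {b : B}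
    (h : (Q a).toReal * (P a b).toReal ≠ 0) : 0 < likelihoodRatio P Q a b := by
  have := toReal_bind_pos P Q h
  have hp : (P a b).toReal ≠ 0 := right_ne_zero_of_mul h
  unfold likelihoodRatio
  positivity

/-- An input that is drawn independently of the output has mean likelihood ratio at most `1`. -/
theorem sum_likelihoodRatio_le_one [Fintype B] (P : DMC A B) (Q : PMF A) :
    ∑ a, Q a * ∑ a', Q a' * ∑ b, P a b * ENNReal.ofReal (likelihoodRatio P Q a' b) ≤ 1 := by
  have h1 : ∀ b, ∑ a', Q a' * ENNReal.ofReal (likelihoodRatio P Q a' b) ≤ 1 := by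
    intro b
    have : ∀ a', Q a' * ENNReal.ofReal (likelihoodRatio P Q a' b) =
        ENNReal.ofReal ((Q a').toReal * (P a' b).toReal / (Q.bind P b).toReal) := by
      intro a'
      rw [mul_div_assoc, ENNReal.ofReal_mul ENNReal.toReal_nonneg,
        ENNReal.ofReal_toReal (PMF.apply_ne_top _ _), likelihoodRatio]
    simp_rw [this]
    rw [← ENNReal.ofReal_sum_of_nonneg (fun a _ => by positivity), ← Finset.sum_div,
      ← toReal_bind_apply]
    exact ENNReal.ofReal_le_one.2 (div_self_le_one _)
  have h2 : ∀ a, ∑ a', Q a' * ∑ b, P a b * ENNReal.ofReal (likelihoodRatio P Q a' b) ≤ 1 := by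
    intro a
    simp_rw [Finset.mul_sum]
    rw [Finset.sum_comm]
    calc _ = ∑ b, P a b * ∑ a', Q a' * ENNReal.ofReal (likelihoodRatio P Q a' b) := by
          refine Finset.sum_congr rfl fun b _ => ?_
          rw [Finset.mul_sum]
          exact Finset.sum_congr rfl fun a' _ => by ring
      _ ≤ ∑ b, P a b * 1 := by gcongr with b; exact h1 b
      _ = 1 := by
        simp_rw [mul_one]; rw [← tsum_fintype (L := .unconditional _), PMF.tsum_coe]
  calc _ ≤ ∑ a, Q a * 1 := by gcongr with a; exact h2 a
    _ = 1 := by simp_rw [mul_one]; rw [← tsum_fintype (L := .unconditional _), PMF.tsum_coe]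

/-- The Chernoff weight `(G / W)^s` of a likelihood ratio `W`, with value `∞` at `W = 0`. -/
noncomputable def chernoffWeight (P : DMC A B) (Q : PMF A) (G s : ℝ) (a : A) (b : B) : ENNReal :=
  open Classical in
  if likelihoodRatio P Q a b = 0 then ⊤ else ENNReal.ofReal ((G / likelihoodRatio P Q a b) ^ s)

/-- If `log G` is below the mutual information then some Chernoff weight has mean less than `1`:
as a function of `s` the mean is `1` at `s = 0`, where its derivative is
`log G - (log 2) I(A;B)`. -/
theorem exists_chernoffWeight_mean_lt_one [Fintype B] (P : DMC A B) (Q : PMF A) {G : ℝ}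
    (hG : 0 < G) (h : Real.logb 2 G < mutualInformation P Q) :
    ∃ s : ℝ, 0 < s ∧ ∑ a, Q a * ∑ b, P a b * chernoffWeight P Q G s a b < 1 := by
  let φ : ℝ → ℝ := fun s =>
    ∑ a, ∑ b, (Q a).toReal * (P a b).toReal * (G / likelihoodRatio P Q a b) ^ s
  have hsum : ∑ a, ∑ b, (Q a).toReal * (P a b).toReal = 1 := by
    simp_rw [← Finset.mul_sum, sum_toReal_pmf, mul_one, sum_toReal_pmf]
  have hφ0 : φ 0 = 1 := by simp [φ, hsum]
  have hd : HasDerivAt φ (∑ a, ∑ b, (Q a).toReal * (P a b).toReal *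
      Real.log (G / likelihoodRatio P Q a b)) 0 := by
    refine HasDerivAt.fun_sum fun a _ => HasDerivAt.fun_sum fun b _ => ?_
    by_cases h0 : (Q a).toReal * (P a b).toReal = 0
    · simp only [h0, zero_mul]; exact hasDerivAt_const _ _
    · have hW := likelihoodRatio_pos P Q h0
      have := (Real.hasStrictDerivAt_const_rpow (a := G / likelihoodRatio P Q a b)
        (by positivity) 0).hasDerivAt
      simpa using this.const_mul ((Q a).toReal * (P a b).toReal)
  have hneg : (∑ a, ∑ b, (Q a).toReal * (P a b).toReal *
      Real.log (G / likelihoodRatio P Q a b)) < 0 := by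
    have e : ∀ a b, (Q a).toReal * (P a b).toReal * Real.log (G / likelihoodRatio P Q a b) =
        (Q a).toReal * (P a b).toReal * Real.log G -
          Real.log 2 * ((Q a).toReal * (P a b).toReal *
            Real.logb 2 ((P a b).toReal / (Q.bind P b).toReal)) := by
      intro a b
      by_cases h0 : (Q a).toReal * (P a b).toReal = 0
      · simp [h0]
      · have hW := likelihoodRatio_pos P Q h0
        rw [Real.log_div hG.ne' hW.ne', likelihoodRatio, Real.logb]
        have : Real.log 2 ≠ 0 := (Real.log_pos one_lt_two).ne'
        field_simp
    have e2 : ∑ a, ∑ b, (Q a).toReal * (P a b).toReal * Real.log G = Real.log G := by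
      simp_rw [← Finset.sum_mul]
      rw [hsum, one_mul]
    have e3 : ∑ a, ∑ b, Real.log 2 * ((Q a).toReal * (P a b).toReal *
        Real.logb 2 ((P a b).toReal / (Q.bind P b).toReal)) =
        Real.log 2 * mutualInformation P Q := by
      simp_rw [mutualInformation, Finset.mul_sum]
    simp_rw [e, Finset.sum_sub_distrib]
    rw [e2, e3]
    rw [Real.logb, div_lt_iff₀ (Real.log_pos one_lt_two)] at h
    linarith
  have hev : ∀ᶠ s in 𝓝[>] (0 : ℝ), φ s < 1 := by
    have := hd.tendsto_slope.mono_left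
      (nhdsWithin_mono 0 (fun x (hx : 0 < x) => hx.ne') : 𝓝[>] (0 : ℝ) ≤ _)
    filter_upwards [this.eventually (gt_mem_nhds hneg), self_mem_nhdsWithin] with s hs hs0
    have hs0 : 0 < s := hs0
    rw [slope_def_field, sub_zero, hφ0, div_lt_iff₀ hs0] at hs
    linarith
  obtain ⟨s, hs, hs0⟩ := (hev.and self_mem_nhdsWithin).exists
  refine ⟨s, hs0, ?_⟩
  have : ∑ a, Q a * ∑ b, P a b * chernoffWeight P Q G s a b = ENNReal.ofReal (φ s) := by
    rw [ENNReal.ofReal_sum_of_nonneg]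
    · refine Finset.sum_congr rfl fun a _ => ?_
      rw [ENNReal.ofReal_sum_of_nonneg, Finset.mul_sum]
      · refine Finset.sum_congr rfl fun b _ => ?_
        rw [ENNReal.ofReal_mul (by positivity), ENNReal.ofReal_mul (by positivity),
          ENNReal.ofReal_toReal (PMF.apply_ne_top _ _), ENNReal.ofReal_toReal
            (PMF.apply_ne_top _ _), ← mul_assoc]
        by_cases h0 : (Q a).toReal * (P a b).toReal = 0
        · have : Q a * P a b = 0 := by
            rw [← ENNReal.toReal_mul, ENNReal.toReal_eq_zero_iff] at h0
            exact h0.resolve_right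
              (ENNReal.mul_ne_top (PMF.apply_ne_top _ _) (PMF.apply_ne_top _ _))
          simp [this]
        · rw [chernoffWeight, if_neg (likelihoodRatio_pos P Q h0).ne']
      · intro b _
        have := likelihoodRatio_nonneg P Q a b
        positivity
    · intro a _
      refine Finset.sum_nonneg fun b _ => ?_
      have := likelihoodRatio_nonneg P Q a b
      positivity
  rw [this]
  exact ENNReal.ofReal_lt_one.2 hs

omit [Fintype A] in
/-- A product of likelihood ratios below `G ^ d` makes the product of Chernoff weights at
least `1`. -/
theorem one_le_prod_chernoffWeight (P : DMC A B) (Q : PMF A) {G s : ℝ} (hG : 0 < G) (hs : 0 < s)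
    {ι : Type*} (T : Finset ι) (a : ι → A) (b : ι → B)
    (h : ∏ i ∈ T, likelihoodRatio P Q (a i) (b i) < G ^ T.card) :
    1 ≤ ∏ i ∈ T, chernoffWeight P Q G s (a i) (b i) := by
  have hW := fun i => likelihoodRatio_nonneg P Q (a i) (b i)
  -- If some ratio vanishes, the product of the weights is `∞`, as no weight is `0`.
  by_cases h0 : ∃ i ∈ T, likelihoodRatio P Q (a i) (b i) = 0
  · obtain ⟨i, hi, hi0⟩ := h0
    have hne : ∀ j ∈ T, chernoffWeight P Q G s (a j) (b j) ≠ 0 := by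
      intro j _
      unfold chernoffWeight
      split_ifs with hj
      · exact ENNReal.top_ne_zero
      · have : 0 < likelihoodRatio P Q (a j) (b j) := lt_of_le_of_ne (hW j) (Ne.symm hj)
        exact (ENNReal.ofReal_pos.2 (by positivity)).ne'
    classical
    rw [← Finset.mul_prod_erase T _ hi, chernoffWeight, if_pos hi0, ENNReal.top_mul]
    · exact le_top
    · exact Finset.prod_ne_zero_iff.2 fun j hj => hne j (Finset.mem_of_mem_erase hj)
  · push Not at h0
    have hpos : ∀ i ∈ T, 0 < likelihoodRatio P Q (a i) (b i) :=
      fun i hi => lt_of_le_of_ne (hW i) (h0 i hi).symm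
    have e : ∏ i ∈ T, chernoffWeight P Q G s (a i) (b i) =
        ENNReal.ofReal ((G ^ T.card / ∏ i ∈ T, likelihoodRatio P Q (a i) (b i)) ^ s) := by
      rw [← Finset.prod_const, ← Finset.prod_div_distrib, ← Real.finsetProd_rpow,
        ENNReal.ofReal_prod_of_nonneg]
      · exact Finset.prod_congr rfl fun i hi => by rw [chernoffWeight, if_neg (h0 i hi)]
      · exact fun i _ => Real.rpow_nonneg (div_nonneg hG.le (hW i)) _
      · exact fun i _ => div_nonneg hG.le (hW i)
    rw [e, ENNReal.one_le_ofReal]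
    refine Real.one_le_rpow ?_ hs.le
    rw [one_le_div (Finset.prod_pos hpos)]
    exact h.le

end InformationTheory

/-! ### Resampling one coordinate of a product measure -/

section Resampling

theorem measurable_update_pair {ι : Type*} [DecidableEq ι] {X : ι → Type*}
    [∀ i, MeasurableSpace (X i)] (i : ι) :
    Measurable fun p : (∀ j, X j) × X i => Function.update p.1 i p.2 := by
  refine measurable_pi_iff.2 fun j => ?_
  by_cases h : j = i
  · subst h; simpa using measurable_snd
  · simp only [Function.update_of_ne h]; fun_prop

/-- Replacing one coordinate of a product measure by an independent copy does not change the
measure. -/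
theorem map_update_infinitePi {ι : Type*} [DecidableEq ι] {X : ι → Type*}
    [∀ i, MeasurableSpace (X i)] (μ : ∀ i, Measure (X i)) [∀ i, IsProbabilityMeasure (μ i)]
    (i : ι) :
    ((Measure.infinitePi μ).prod (μ i)).map (fun p => Function.update p.1 i p.2) =
      Measure.infinitePi μ := by
  refine Measure.eq_infinitePi _ fun s t ht => ?_
  have hm := measurable_update_pair (X := X) i
  rw [Measure.map_apply hm (MeasurableSet.pi s.countable_toSet fun j _ => ht j)]
  have hpre : (fun p : (∀ j, X j) × X i => Function.update p.1 i p.2) ⁻¹' Set.pi s t =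
      Set.pi (s.erase i) t ×ˢ (if i ∈ s then t i else Set.univ) := by
    ext p
    simp only [Set.mem_preimage, Set.mem_pi, Set.mem_prod, Finset.mem_coe, Finset.mem_erase]
    constructor
    · intro h
      refine ⟨fun j hj => by simpa [hj.1] using h j hj.2, ?_⟩
      split_ifs with hi
      · simpa using h i hi
      · trivial
    · rintro ⟨h1, h2⟩ j hj
      by_cases hji : j = i
      · subst hji; simpa [hj] using h2
      · simpa [hji] using h1 j ⟨hji, hj⟩
  rw [hpre, Measure.prod_prod, Measure.infinitePi_pi _ (fun j _ => ht j)]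
  split_ifs with hi
  · rw [mul_comm, Finset.mul_prod_erase s (fun j => μ j (t j)) hi]
  · rw [measure_univ, mul_one, Finset.erase_eq_of_notMem hi]

variable {E F : Type*} [MeasurableSpace E] [MeasurableSpace F]

/-- Resampling the coordinate `t` of two independent iid sequences does not change the mean of a
function of both. -/
theorem lintegral_prod_infinitePi_update (α : Measure E) (β : Measure F)
    [IsProbabilityMeasure α] [IsProbabilityMeasure β] (t : ℕ) {f : (ℕ → E) × (ℕ → F) → ENNReal}
    (hf : Measurable f) :
    ∫⁻ p, f p ∂((Measure.infinitePi fun _ : ℕ => α).prod (Measure.infinitePi fun _ : ℕ => β)) =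
      ∫⁻ p, ∫⁻ y, ∫⁻ w, f (Function.update p.1 t y, Function.update p.2 t w) ∂β ∂α
        ∂((Measure.infinitePi fun _ : ℕ => α).prod (Measure.infinitePi fun _ : ℕ => β)) := by
  have hE := measurable_update_pair (X := fun _ : ℕ => E) t
  have hF := measurable_update_pair (X := fun _ : ℕ => F) t
  have h4 : Measurable fun q : ((ℕ → E) × (ℕ → F)) × (E × F) =>
      f (Function.update q.1.1 t q.2.1, Function.update q.1.2 t q.2.2) :=
    hf.comp ((hE.comp (by fun_prop : Measurable fun q : ((ℕ → E) × (ℕ → F)) × (E × F) =>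
      (q.1.1, q.2.1))).prodMk (hF.comp (by fun_prop :
        Measurable fun q : ((ℕ → E) × (ℕ → F)) × (E × F) => (q.1.2, q.2.2))))
  have e1 : ∀ x : ℕ → E, ∫⁻ z, f (x, z) ∂(Measure.infinitePi fun _ : ℕ => β) =
      ∫⁻ z, ∫⁻ w, f (x, Function.update z t w) ∂β ∂(Measure.infinitePi fun _ : ℕ => β) := by
    intro x
    have hx : Measurable fun z => f (x, z) := hf.comp measurable_prodMk_left
    conv_lhs => rw [← map_update_infinitePi (fun _ : ℕ => β) t]
    rw [lintegral_map hx hF]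
    exact lintegral_prod _ (hx.comp hF).aemeasurable
  have hg : Measurable fun x : ℕ → E => ∫⁻ z, ∫⁻ w, f (x, Function.update z t w) ∂β
      ∂(Measure.infinitePi fun _ : ℕ => β) := by
    simp_rw [← e1]
    exact hf.lintegral_prod_right'
  rw [lintegral_prod _ hf.aemeasurable]
  simp_rw [e1]
  conv_lhs => rw [← map_update_infinitePi (fun _ : ℕ => α) t]
  rw [lintegral_map hg hE]
  refine (lintegral_prod (fun q : (ℕ → E) × E => ∫⁻ z, ∫⁻ w,
    f (Function.update q.1 t q.2, Function.update z t w) ∂β ∂(Measure.infinitePi fun _ : ℕ => β))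
    (hg.comp hE).aemeasurable).trans ?_
  rw [lintegral_prod]
  · refine lintegral_congr fun x => ?_
    rw [lintegral_lintegral_swap]
    refine Measurable.aemeasurable ?_
    have : Measurable fun q : (E × (ℕ → F)) × F =>
        f (Function.update x t q.1.1, Function.update q.1.2 t q.2) :=
      h4.comp (by fun_prop : Measurable fun q : (E × (ℕ → F)) × F =>
        (((x, q.1.2), (q.1.1, q.2)) : ((ℕ → E) × (ℕ → F)) × (E × F)))
    exact this.lintegral_prod_right'
  · refine Measurable.aemeasurable ?_
    have : Measurable fun q : (((ℕ → E) × (ℕ → F)) × E) × F =>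
        f (Function.update q.1.1.1 t q.1.2, Function.update q.1.1.2 t q.2) :=
      h4.comp (by fun_prop : Measurable fun q : (((ℕ → E) × (ℕ → F)) × E) × F =>
        ((q.1.1, (q.1.2, q.2)) : ((ℕ → E) × (ℕ → F)) × (E × F)))
    exact this.lintegral_prod_right'.lintegral_prod_right'

/-- A product of factors, each of which is determined by the randomness up to its own time and
has conditional mean at most `θ` given the earlier randomness, has mean at most `θ ^ (K - j)`. -/
theorem lintegral_prod_Ico_le (α : Measure E) (β : Measure F)
    [IsProbabilityMeasure α] [IsProbabilityMeasure β] {f : ℕ → (ℕ → E) × (ℕ → F) → ENNReal}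
    (hf : ∀ i, Measurable (f i))
    (hcausal : ∀ i t, i < t → ∀ (p : (ℕ → E) × (ℕ → F)) y w,
      f i (Function.update p.1 t y, Function.update p.2 t w) = f i p)
    {θ : ENNReal} {j K : ℕ} (hjK : j ≤ K)
    (hmean : ∀ t, j ≤ t → ∀ p : (ℕ → E) × (ℕ → F),
      ∫⁻ y, ∫⁻ w, f t (Function.update p.1 t y, Function.update p.2 t w) ∂β ∂α ≤ θ) :
    ∫⁻ p, ∏ t ∈ Finset.Ico j K, f t p
      ∂((Measure.infinitePi fun _ : ℕ => α).prod (Measure.infinitePi fun _ : ℕ => β)) ≤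
      θ ^ (K - j) := by
  induction K, hjK using Nat.le_induction with
  | base => simp
  | succ K hK ih =>
    have hM : Measurable fun p => ∏ t ∈ Finset.Ico j K, f t p :=
      Finset.measurable_fun_prod _ fun t _ => hf t
    have hE := measurable_update_pair (X := fun _ : ℕ => E) K
    have hF := measurable_update_pair (X := fun _ : ℕ => F) K
    have hfK : ∀ p : (ℕ → E) × (ℕ → F), Measurable fun q : E × F =>
        f K (Function.update p.1 K q.1, Function.update p.2 K q.2) := fun p =>
      (hf K).comp (((hE.comp (measurable_prodMk_left (x := p.1))).comp measurable_fst).prodMk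
        ((hF.comp (measurable_prodMk_left (x := p.2))).comp measurable_snd))
    simp_rw [Finset.prod_Ico_succ_top hK]
    have hMf : Measurable fun p => (∏ t ∈ Finset.Ico j K, f t p) * f K p := hM.mul (hf K)
    rw [lintegral_prod_infinitePi_update α β K hMf]
    calc _ ≤ ∫⁻ p, (∏ t ∈ Finset.Ico j K, f t p) * θ
          ∂((Measure.infinitePi fun _ : ℕ => α).prod (Measure.infinitePi fun _ : ℕ => β)) := by
          refine lintegral_mono fun p => ?_
          have : ∀ y w, ∏ t ∈ Finset.Ico j K,
              f t (Function.update p.1 K y, Function.update p.2 K w) =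
              ∏ t ∈ Finset.Ico j K, f t p := fun y w =>
            Finset.prod_congr rfl fun t ht => hcausal t K (Finset.mem_Ico.1 ht).2 p y w
          simp only [this]
          have h2 : ∀ y, ∫⁻ w, (∏ t ∈ Finset.Ico j K, f t p) *
              f K (Function.update p.1 K y, Function.update p.2 K w) ∂β =
              (∏ t ∈ Finset.Ico j K, f t p) *
              ∫⁻ w, f K (Function.update p.1 K y, Function.update p.2 K w) ∂β := fun y =>
            lintegral_const_mul _ ((hfK p).comp measurable_prodMk_left)
          simp_rw [h2]
          rw [lintegral_const_mul _ (hfK p).lintegral_prod_right']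
          gcongr
          exact hmean K hK p
      _ ≤ θ ^ (K - j) * θ := by
          rw [lintegral_mul_const _ hM]
          gcongr
      _ = θ ^ (K + 1 - j) := by rw [← pow_succ, Nat.sub_add_comm hK]

end Resampling

/-! ### Means over fresh labels and a fresh channel map -/

section FreshLabel

variable {A : Type u} {B : Type v} [Fintype A] [Fintype B]
  [MeasurableSpace A] [MeasurableSingletonClass A] [MeasurableSpace B] [MeasurableSingletonClass B]

/-- The law of the labels of all bins at a single sampling time. -/
noncomputable abbrev labelRowLaw (Q : PMF A) (n : ℕ) : Measure (ℤ → Fin n → A) :=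
  Measure.infinitePi fun _ : ℤ => Measure.pi fun _ : Fin n => Q.toMeasure

/-- The law of the random channel map at a single time. -/
noncomputable abbrev channelMapLaw (P : DMC A B) : Measure (A → B) :=
  Measure.pi fun a => (P a).toMeasure

theorem lintegral_pmf_toMeasure {α : Type*} [Fintype α] [MeasurableSpace α]
    [MeasurableSingletonClass α] (Q : PMF α) (f : α → ENNReal) :
    ∫⁻ a, f a ∂Q.toMeasure = ∑ a, Q a * f a := by
  rw [lintegral_fintype]
  refine Finset.sum_congr rfl fun a _ => ?_
  rw [PMF.toMeasure_apply_singleton _ _ (measurableSet_singleton a), mul_comm]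

omit [MeasurableSpace A] [MeasurableSingletonClass A] in
theorem lintegral_channelMapLaw (P : DMC A B) (a : A) (f : B → ENNReal) :
    ∫⁻ w, f (w a) ∂channelMapLaw P = ∑ b, P a b * f b := by
  rw [← lintegral_pmf_toMeasure, ← (measurePreserving_eval (fun a => (P a).toMeasure) a).map_eq,
    lintegral_map (measurable_of_countable f) (measurable_pi_apply a)]

omit [Fintype A] [MeasurableSingletonClass A] in
theorem map_eval_labelRowLaw (Q : PMF A) (c : ℤ) :
    (labelRowLaw Q 1).map (fun y => y c 0) = Q.toMeasure := by
  rw [← (measurePreserving_eval (fun _ : Fin 1 => Q.toMeasure) 0).map_eq,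
    ← Measure.infinitePi_map_eval (fun _ : ℤ => Measure.pi fun _ : Fin 1 => Q.toMeasure) c,
    Measure.map_map (measurable_pi_apply 0) (measurable_pi_apply c)]
  rfl

omit [MeasurableSingletonClass A] in
theorem map_eval_pair_labelRowLaw (Q : PMF A) {c c' : ℤ} (h : c ≠ c') :
    (labelRowLaw Q 1).map (fun y => (y c 0, y c' 0)) = Q.toMeasure.prod Q.toMeasure := by
  have h0 := (measurePreserving_eval (fun _ : Fin 1 => Q.toMeasure) 0)
  have h1 := Measure.infinitePi_map_eval_prod
    (P := fun _ : ℤ => Measure.pi fun _ : Fin 1 => Q.toMeasure) h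
  conv_rhs => rw [← h0.map_eq]
  rw [Measure.map_prod_map _ _ h0.measurable h0.measurable, ← h1,
    Measure.map_map (by fun_prop) (by fun_prop)]
  rfl

/-- Mean of a function of the fresh label of the transmitted bin and the channel output. -/
theorem lintegral_transmitted (P : DMC A B) (Q : PMF A) (c : ℤ) (H : A → B → ENNReal) :
    ∫⁻ y, ∫⁻ w, H (y c 0) (w (y c 0)) ∂channelMapLaw P ∂labelRowLaw Q 1 =
      ∑ a, Q a * ∑ b, P a b * H a b := by
  simp_rw [fun y : ℤ → Fin 1 → A => lintegral_channelMapLaw P (y c 0) (H (y c 0))]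
  rw [← lintegral_pmf_toMeasure Q (fun a => ∑ b, P a b * H a b), ← map_eval_labelRowLaw Q c,
    lintegral_map (measurable_of_countable _) (by fun_prop)]

/-- Mean of a function of the fresh label of a bin that is not transmitted and the channel
output. -/
theorem lintegral_untransmitted (P : DMC A B) (Q : PMF A) {c c' : ℤ} (h : c ≠ c')
    (H : A → B → ENNReal) :
    ∫⁻ y, ∫⁻ w, H (y c' 0) (w (y c 0)) ∂channelMapLaw P ∂labelRowLaw Q 1 =
      ∑ a, Q a * ∑ a', Q a' * ∑ b, P a b * H a' b := by
  simp_rw [fun y : ℤ → Fin 1 → A => lintegral_channelMapLaw P (y c 0) (H (y c' 0))]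
  simp_rw [← lintegral_pmf_toMeasure Q]
  rw [lintegral_lintegral (f := fun a a' => ∑ b, P a b * H a' b)
      (measurable_of_countable _).aemeasurable, ← map_eval_pair_labelRowLaw Q h,
    lintegral_map (measurable_of_countable _) (by fun_prop)]

end FreshLabel

/-! ### Cells of the initial condition -/

section Cells

/-- The index of the cell of the hypothetical initial condition `x` at time `t`: the bin to which
the quantizer with `Δ = 2 ρ ^ t` would assign the uncontrolled state `lam ^ t * x`, where
`μ = lam / ρ`. -/
noncomputable def cell (μ : ℝ) (t : ℕ) (x : ℝ) : ℤ := ⌈μ ^ t * x - 1 / 2⌉ - 1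

theorem cell_mono {μ : ℝ} (hμ : 0 ≤ μ) (t : ℕ) : Monotone (cell μ t) := by
  intro x y hxy
  have : μ ^ t * x ≤ μ ^ t * y := by gcongr
  exact sub_le_sub_right (Int.ceil_mono (by linarith)) 1

theorem abs_sub_cell_le (μ : ℝ) (t : ℕ) (x : ℝ) : |μ ^ t * x - cell μ t x| ≤ 3 / 2 := by
  have h1 := Int.le_ceil (μ ^ t * x - 1 / 2)
  have h2 := Int.ceil_lt_add_one (μ ^ t * x - 1 / 2)
  rw [abs_le]
  unfold cell
  push_cast
  constructor <;> linarith

theorem cell_sub_cell_le (μ : ℝ) (t : ℕ) (x y : ℝ) :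
    ((cell μ t y - cell μ t x : ℤ) : ℝ) ≤ μ ^ t * (y - x) + 1 := by
  have h1 := Int.le_ceil (μ ^ t * x - 1 / 2)
  have h2 := Int.ceil_lt_add_one (μ ^ t * y - 1 / 2)
  unfold cell
  push_cast
  linarith

theorem cell_ne_of_one_le {μ : ℝ} {t : ℕ} {x y : ℝ} (h : 1 ≤ μ ^ t * |x - y|) :
    cell μ t x ≠ cell μ t y := by
  wlog hxy : y ≤ x generalizing x y
  · exact (this (by rwa [abs_sub_comm]) (le_of_not_ge hxy)).symm
  rw [abs_of_nonneg (sub_nonneg.2 hxy)] at h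
  have : ⌈μ ^ t * y - 1 / 2⌉ + 1 ≤ ⌈μ ^ t * x - 1 / 2⌉ := by
    rw [← Int.ceil_add_one]
    exact Int.ceil_mono (by linarith)
  unfold cell
  omega

/-- The controller keeps the state of the form `lam ^ t * x0 - ρ ^ t * s` with `s ∈ ℤ`, so that
its controls shift the bin indices. -/
theorem latticeBin_eq_cell_sub {lam ρ : ℝ} (hρ : 0 < ρ) (t : ℕ) (x0 : ℝ) (s : ℤ) :
    latticeBin (2 * ρ ^ t) (lam ^ t * x0 - ρ ^ t * s) = cell (lam / ρ) t x0 - s := by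
  unfold latticeBin cell
  have hp : ρ ^ t ≠ 0 := by positivity
  have : 2 * (lam ^ t * x0 - ρ ^ t * s) / (2 * ρ ^ t) - 1 / 2 =
      ((lam / ρ) ^ t * x0 - 1 / 2) - (s : ℤ) := by
    rw [div_pow]
    field_simp
    ring
  rw [this, Int.ceil_sub_intCast]
  ring

/-- The cells are monotone in the initial condition, so the sum of the cell indices over a time
window already determines each of them. -/
theorem cell_eq_of_sum_eq {μ : ℝ} (hμ : 0 ≤ μ) (T : Finset ℕ) {x y : ℝ}
    (h : ∑ t ∈ T, cell μ t x = ∑ t ∈ T, cell μ t y) : ∀ t ∈ T, cell μ t x = cell μ t y := by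
  wlog hxy : x ≤ y generalizing x y
  · exact fun t ht => (this h.symm (le_of_not_ge hxy) t ht).symm
  exact (Finset.sum_eq_sum_iff_of_le fun t _ => cell_mono hμ t hxy).1 h

/-- Countably many initial conditions in `[-r, r]` realize all cell sequences of length `K`. -/
theorem exists_cell_representatives (μ : ℝ) {r : ℝ} (hr : 0 ≤ r) :
    ∃ e : ℕ → ℕ → ℝ, (∀ K i, |e K i| ≤ r) ∧
      ∀ K x, |x| ≤ r → ∃ i, ∀ t < K, cell μ t (e K i) = cell μ t x := by
  have : ∀ K : ℕ, ∃ f : ℕ → ℝ, (∀ i, |f i| ≤ r) ∧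
      ∀ x, |x| ≤ r → ∃ i, ∀ t < K, cell μ t (f i) = cell μ t x := by
    intro K
    let T : ℝ → Fin K → ℤ := fun x t => cell μ t x
    obtain ⟨g, hg⟩ := (Set.to_countable (T '' {x | |x| ≤ r})).exists_eq_range
      ⟨_, 0, by simpa using hr, rfl⟩
    have hmem : ∀ i, ∃ x, |x| ≤ r ∧ T x = g i := fun i => by
      have : g i ∈ T '' {x | |x| ≤ r} := hg ▸ Set.mem_range_self i
      exact this
    choose f hf hfg using hmem
    refine ⟨f, hf, fun x hx => ?_⟩
    have : T x ∈ Set.range g := hg ▸ Set.mem_image_of_mem T hx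
    obtain ⟨i, hi⟩ := this
    exact ⟨i, fun t ht => congrFun ((hfg i).trans hi) ⟨t, ht⟩⟩
  choose e he1 he2 using this
  exact ⟨e, he1, he2⟩

end Cells

/-! ### The decoder -/

section Decoder

/-- The least index that satisfies `p`, and `0` if there is none. -/
noncomputable def firstIndex (p : ℕ → Prop) : ℕ :=
  open Classical in Nat.find (p := fun i => p i ∨ ∀ i', ¬ p i') <| by
    by_cases h : ∃ i, p i
    · exact h.imp fun _ => Or.inl
    · exact ⟨0, Or.inr (not_exists.1 h)⟩

theorem firstIndex_spec {p : ℕ → Prop} (h : ∃ i, p i) : p (firstIndex p) := by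
  classical
  unfold firstIndex
  generalize_proofs hp
  exact (Nat.find_spec hp).resolve_right fun hn => h.elim hn

theorem measurable_firstIndex {Ω : Type*} [MeasurableSpace Ω] {p : Ω → ℕ → Prop}
    (hp : ∀ i, MeasurableSet {ω | p ω i}) : Measurable fun ω => firstIndex (p ω) := by
  classical
  unfold firstIndex
  refine measurable_find _ fun i => ?_
  simp only [Set.ofPred_or, Set.ofPred_forall]
  exact (hp i).union (MeasurableSet.iInter fun i' => (hp i').compl)

variable {A : Type u} {B : Type v}

/-- The test that the decoder applies at time `K` to the initial condition `x`, given the labels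
`l`, the channel outputs `b` and the shifts `s` of the bin indices.  For each sufficiently long
final window `[j, K)`, the letters that `x` would have sent must have likelihood ratios with
product at least `G ^ (K - j)`. -/
def Accepts (P : DMC A B) (Q : PMF A) (μ G : ℝ) (q : ℕ) (l : Labels A 1) (b : ℕ → B)
    (s : ℕ → ℤ) (K : ℕ) (x : ℝ) : Prop :=
  ∀ j < K, K ≤ q * (K - j) →
    G ^ (K - j) ≤ ∏ t ∈ Finset.Ico j K, likelihoodRatio P Q (l t (cell μ t x - s t) 0) (b t)

theorem accepts_congr (P : DMC A B) (Q : PMF A) (μ G : ℝ) (q : ℕ) {l l' : Labels A 1}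
    {b b' : ℕ → B} {s s' : ℕ → ℤ} {K : ℕ} {x x' : ℝ} (hl : ∀ t < K, l t = l' t)
    (hb : ∀ t < K, b t = b' t) (hs : ∀ t < K, s t = s' t)
    (hx : ∀ t < K, cell μ t x = cell μ t x') :
    Accepts P Q μ G q l b s K x ↔ Accepts P Q μ G q l' b' s' K x' := by
  unfold Accepts
  refine forall_congr' fun j => forall_congr' fun _ => forall_congr' fun _ => ?_
  rw [Finset.prod_congr rfl fun t ht => ?_]
  have := (Finset.mem_Ico.1 ht).2
  rw [hl t this, hb t this, hs t this, hx t this]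

/-- The shift that the controller aims at for time `K`: the cell of the first candidate initial
condition `e K i` that passes the test. At time `0` there is no control yet, hence no shift. -/
noncomputable def decode (P : DMC A B) (Q : PMF A) (μ G : ℝ) (q : ℕ) (e : ℕ → ℕ → ℝ)
    (l : Labels A 1) (b : ℕ → B) (s : ℕ → ℤ) (K : ℕ) : ℤ :=
  if K = 0 then 0 else cell μ K (e K (firstIndex fun i => Accepts P Q μ G q l b s K (e K i)))

theorem decode_congr (P : DMC A B) (Q : PMF A) (μ G : ℝ) (q : ℕ) (e : ℕ → ℕ → ℝ)
    {l l' : Labels A 1} {b b' : ℕ → B} {s s' : ℕ → ℤ} {K : ℕ} (hl : ∀ t < K, l t = l' t)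
    (hb : ∀ t < K, b t = b' t) (hs : ∀ t < K, s t = s' t) :
    decode P Q μ G q e l b s K = decode P Q μ G q e l' b' s' K := by
  unfold decode
  simp_rw [accepts_congr P Q μ G q hl hb hs fun _ _ => rfl]

/-- The integer shift of the bin indices at time `K`, as a function of the labels and channel
outputs before time `K`. -/
noncomputable def shift (P : DMC A B) (Q : PMF A) (μ G : ℝ) (q : ℕ) (e : ℕ → ℕ → ℝ)
    (l : Labels A 1) (b : ℕ → B) (K : ℕ) : ℤ :=
  decode P Q μ G q e l b (fun t => if _h : t < K then shift P Q μ G q e l b t else 0) K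
termination_by K

theorem shift_eq_decode (P : DMC A B) (Q : PMF A) (μ G : ℝ) (q : ℕ) (e : ℕ → ℕ → ℝ)
    (l : Labels A 1) (b : ℕ → B) (K : ℕ) :
    shift P Q μ G q e l b K = decode P Q μ G q e l b (shift P Q μ G q e l b) K := by
  rw [shift]
  exact decode_congr P Q μ G q e (fun _ _ => rfl) (fun _ _ => rfl) fun t ht => by simp [ht]

theorem shift_zero (P : DMC A B) (Q : PMF A) (μ G : ℝ) (q : ℕ) (e : ℕ → ℕ → ℝ)
    (l : Labels A 1) (b : ℕ → B) : shift P Q μ G q e l b 0 = 0 := by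
  rw [shift_eq_decode, decode, if_pos rfl]

theorem shift_congr (P : DMC A B) (Q : PMF A) (μ G : ℝ) (q : ℕ) (e : ℕ → ℕ → ℝ)
    {l l' : Labels A 1} {b b' : ℕ → B} {K : ℕ} (hl : ∀ t < K, l t = l' t)
    (hb : ∀ t < K, b t = b' t) : shift P Q μ G q e l b K = shift P Q μ G q e l' b' K := by
  induction K using Nat.strong_induction_on with
  | _ K ih =>
    rw [shift_eq_decode, shift_eq_decode]
    exact decode_congr P Q μ G q e hl hb fun t ht =>
      ih t ht (fun i hi => hl i (hi.trans ht)) fun i hi => hb i (hi.trans ht)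

variable [Countable A] [Countable B] [MeasurableSpace A] [MeasurableSingletonClass A] [MeasurableSpace B]
  [MeasurableSingletonClass B] {Ω : Type*} [MeasurableSpace Ω]

omit [Countable A] [MeasurableSingletonClass A] in
theorem measurable_label {l : Ω → Labels A 1} (hl : Measurable l) (t : ℕ) {c : Ω → ℤ}
    (hc : Measurable c) : Measurable fun ω => l ω t (c ω) 0 := by
  have : Measurable fun p : ℤ × Ω => l p.2 t p.1 0 :=
    measurable_from_prod_countable_right fun c => (measurable_pi_apply 0).comp
      ((measurable_pi_apply c).comp ((measurable_pi_apply t).comp hl))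
  exact this.comp (hc.prodMk measurable_id)

theorem measurable_shift (P : DMC A B) (Q : PMF A) (μ G : ℝ) (q : ℕ) (e : ℕ → ℕ → ℝ)
    {l : Ω → Labels A 1} (hl : Measurable l) {b : Ω → ℕ → B} {K : ℕ}
    (hb : ∀ t < K, Measurable fun ω => b ω t) :
    Measurable fun ω => shift P Q μ G q e (l ω) (b ω) K := by
  induction K using Nat.strong_induction_on with
  | _ K ih =>
    simp_rw [shift_eq_decode P Q μ G q e _ _ K, decode]
    split_ifs with hK
    · exact measurable_const
    refine (measurable_of_countable fun i => cell μ K (e K i)).comp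
      (measurable_firstIndex fun i => ?_)
    simp only [Accepts, Set.ofPred_forall]
    refine MeasurableSet.iInter fun j => MeasurableSet.iInter fun _ => MeasurableSet.iInter
      fun _ => measurableSet_le measurable_const (Finset.measurable_fun_prod _ fun t ht => ?_)
    have htK := (Finset.mem_Ico.1 ht).2
    have hs := ih t htK fun i hi => hb i (hi.trans htK)
    exact (measurable_of_countable fun p : A × B => likelihoodRatio P Q p.1 p.2).comp
      ((measurable_label hl t (measurable_const.sub hs)).prodMk (hb t htK))

end Decoder

/-! ### The closed loop -/

section ClosedLoop

variable {A : Type u} {B : Type v} [Fintype A] [Fintype B]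
  [MeasurableSpace A] [MeasurableSingletonClass A] [MeasurableSpace B] [MeasurableSingletonClass B]

theorem measurable_latticeBin (Δ : ℝ) : Measurable (latticeBin Δ) := by
  unfold latticeBin
  exact (Int.measurable_ceil.comp (by fun_prop)).sub measurable_const

omit [Fintype A] [MeasurableSingletonClass A] in
theorem measurable_latticeObserver (n : ℕ) (hn : 0 < n) (Δ : ℕ → ℝ) (t : ℕ) :
    Measurable fun p : Labels A n × (Fin (t + 1) → ℝ) => latticeObserver n hn Δ t p.1 p.2 := by
  unfold latticeObserver
  have : Measurable fun p : ℤ × Labels A n => p.2 (t / n) p.1 ⟨t % n, Nat.mod_lt t hn⟩ :=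
    measurable_from_prod_countable_right fun c => (measurable_pi_apply _).comp
      ((measurable_pi_apply c).comp (measurable_pi_apply (t / n)))
  exact this.comp (((measurable_latticeBin _).comp
    ((measurable_pi_apply _).comp measurable_snd)).prodMk measurable_fst)

/-- Extension of a finite output history to an infinite sequence; the values beyond time `t` do
not matter. -/
def extendOutputs {t : ℕ} (b : Fin (t + 1) → B) (i : ℕ) : B :=
  if h : i < t + 1 then b ⟨i, h⟩ else b 0

/-- The lattice observer with block length `1` and `Δ_t = 2 ρ ^ t`, together with the controller
that moves the state from `lam ^ t * x0 - ρ ^ t * s_t` to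
`lam ^ (t + 1) * x0 - ρ ^ (t + 1) * s_{t + 1}`, where `s` is the decoder's sequence of shifts. -/
noncomputable def latticeScheme (P : DMC A B) (Q : PMF A) (lam ρ G : ℝ) (q : ℕ)
    (e : ℕ → ℕ → ℝ) : Scheme A B (Labels A 1) where
  observer := latticeObserver 1 one_pos fun t => 2 * ρ ^ t
  controller t l b := lam * ρ ^ t * shift P Q (lam / ρ) G q e l (extendOutputs b) t -
    ρ ^ (t + 1) * shift P Q (lam / ρ) G q e l (extendOutputs b) (t + 1)
  measurable_observer t := measurable_latticeObserver 1 one_pos _ t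
  measurable_controller t := by
    have hb : ∀ i, Measurable fun p : Labels A 1 × (Fin (t + 1) → B) =>
        extendOutputs p.2 i := by
      intro i
      unfold extendOutputs
      split_ifs <;> fun_prop
    have hs : ∀ K, Measurable fun p : Labels A 1 × (Fin (t + 1) → B) =>
        (shift P Q (lam / ρ) G q e p.1 (extendOutputs p.2) K : ℝ) := fun K =>
      (measurable_of_countable fun z : ℤ => (z : ℝ)).comp
        (measurable_shift P Q (lam / ρ) G q e measurable_fst fun t _ => hb t)
    exact ((hs t).const_mul _).sub ((hs (t + 1)).const_mul _)

variable (P : DMC A B) (Q : PMF A) (lam ρ G : ℝ) (q : ℕ) (e : ℕ → ℕ → ℝ) (x0 : ℝ)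

/-- The channel outputs in the closed loop of `latticeScheme`. -/
noncomputable def loopOutput (p : Labels A 1 × (ℕ → A → B)) (t : ℕ) : B :=
  (latticeScheme P Q lam ρ G q e).output lam (fun _ => 0) x0 p.1 p.2 t

/-- The shifts in the closed loop of `latticeScheme`. -/
noncomputable def loopShift (p : Labels A 1 × (ℕ → A → B)) (t : ℕ) : ℤ :=
  shift P Q (lam / ρ) G q e p.1 (loopOutput P Q lam ρ G q e x0 p) t

theorem latticeScheme_state (p : Labels A 1 × (ℕ → A → B)) (t : ℕ) :
    (latticeScheme P Q lam ρ G q e).state lam (fun _ => 0) x0 p.1 p.2 t =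
      lam ^ t * x0 - ρ ^ t * loopShift P Q lam ρ G q e x0 p t := by
  induction t with
  | zero => simp [Scheme.state_zero, loopShift, shift_zero]
  | succ t ih =>
    have hext : ∀ i < t + 1, extendOutputs (fun i : Fin (t + 1) =>
        (latticeScheme P Q lam ρ G q e).output lam (fun _ => 0) x0 p.1 p.2 i) i =
        loopOutput P Q lam ρ G q e x0 p i := fun i hi => by
      rw [extendOutputs, dif_pos hi]; rfl
    rw [Scheme.state_succ, ih]
    simp only [latticeScheme] at hext ⊢
    rw [shift_congr P Q (lam / ρ) G q e (fun _ _ => rfl) fun i hi => hext i (hi.trans (by omega)),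
      shift_congr P Q (lam / ρ) G q e (fun _ _ => rfl) hext]
    simp only [loopShift]
    ring

variable {ρ} in
theorem loopOutput_eq (hρ : 0 < ρ) (p : Labels A 1 × (ℕ → A → B)) (t : ℕ) :
    loopOutput P Q lam ρ G q e x0 p t =
      p.2 t (p.1 t (cell (lam / ρ) t x0 - loopShift P Q lam ρ G q e x0 p t) 0) := by
  rw [loopOutput, Scheme.output_eq]
  simp_rw [latticeScheme_state]
  simp only [latticeScheme, latticeObserver, Nat.div_one, Nat.mul_one, latticeBin_eq_cell_sub hρ]
  rw [Subsingleton.elim (⟨t % 1, Nat.mod_lt t one_pos⟩ : Fin 1) 0]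

/-- The outputs before time `t` depend only on the labels and channel maps before time `t`. -/
theorem loopOutput_congr (hρ : 0 < ρ) {p p' : Labels A 1 × (ℕ → A → B)} {t : ℕ}
    (h1 : ∀ i < t, p.1 i = p'.1 i) (h2 : ∀ i < t, p.2 i = p'.2 i) :
    ∀ i < t, loopOutput P Q lam ρ G q e x0 p i = loopOutput P Q lam ρ G q e x0 p' i := by
  intro i
  induction i using Nat.strong_induction_on with
  | _ i ih =>
    intro hi
    have : loopShift P Q lam ρ G q e x0 p i = loopShift P Q lam ρ G q e x0 p' i :=
      shift_congr P Q (lam / ρ) G q e (fun k hk => h1 k (hk.trans hi))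
        fun k hk => ih k hk (hk.trans hi)
    rw [loopOutput_eq P Q lam G q e x0 hρ, loopOutput_eq P Q lam G q e x0 hρ, this, h1 i hi,
      h2 i hi]

theorem loopShift_congr (hρ : 0 < ρ) {p p' : Labels A 1 × (ℕ → A → B)} {t : ℕ}
    (h1 : ∀ i < t, p.1 i = p'.1 i) (h2 : ∀ i < t, p.2 i = p'.2 i) :
    loopShift P Q lam ρ G q e x0 p t = loopShift P Q lam ρ G q e x0 p' t :=
  shift_congr P Q (lam / ρ) G q e h1 (loopOutput_congr P Q lam ρ G q e x0 hρ h1 h2)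

theorem measurable_loopOutput (hρ : 0 < ρ) (t : ℕ) :
    Measurable fun p => loopOutput P Q lam ρ G q e x0 p t := by
  induction t using Nat.strong_induction_on with
  | _ t ih =>
    simp_rw [loopOutput_eq P Q lam G q e x0 hρ]
    have hs : Measurable fun p => loopShift P Q lam ρ G q e x0 p t :=
      measurable_shift P Q (lam / ρ) G q e measurable_fst ih
    have : Measurable fun r : A × (ℕ → A → B) => r.2 t r.1 :=
      measurable_from_prod_countable_right fun a =>
        (measurable_pi_apply a).comp (measurable_pi_apply t)
    exact this.comp ((measurable_label measurable_fst t (measurable_const.sub hs)).prodMk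
      measurable_snd)

theorem measurable_loopShift (hρ : 0 < ρ) (t : ℕ) :
    Measurable fun p => loopShift P Q lam ρ G q e x0 p t :=
  measurable_shift P Q (lam / ρ) G q e measurable_fst
    fun i _ => measurable_loopOutput P Q lam ρ G q e x0 hρ i

/-- The letter that the initial condition `x` would have sent at time `t` in the closed loop whose
initial condition is `x0`. -/
noncomputable def loopLetter (x : ℝ) (p : Labels A 1 × (ℕ → A → B)) (t : ℕ) : A :=
  p.1 t (cell (lam / ρ) t x - loopShift P Q lam ρ G q e x0 p t) 0

theorem measurable_loopWeight (hρ : 0 < ρ) (x : ℝ) (H : A → B → ENNReal) (t : ℕ) :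
    Measurable fun p => H (loopLetter P Q lam ρ G q e x0 x p t)
      (loopOutput P Q lam ρ G q e x0 p t) :=
  (measurable_of_countable fun r : A × B => H r.1 r.2).comp
    ((measurable_label measurable_fst t (measurable_const.sub
      (measurable_loopShift P Q lam ρ G q e x0 hρ t))).prodMk
      (measurable_loopOutput P Q lam ρ G q e x0 hρ t))

/-- A product over `[j, K)` of weights `H (letter of x) (output)` has mean at most `θ ^ (K - j)`
if each weight has mean at most `θ` over a fresh row of labels and a fresh channel map. -/
theorem lintegral_prod_loop_le (hρ : 0 < ρ) (x : ℝ) (H : A → B → ENNReal) {θ : ENNReal} {j K : ℕ}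
    (hjK : j ≤ K)
    (hmean : ∀ t, j ≤ t → ∀ s : ℤ,
      ∫⁻ y, ∫⁻ w, H (y (cell (lam / ρ) t x - s) 0) (w (y (cell (lam / ρ) t x0 - s) 0))
        ∂channelMapLaw P ∂labelRowLaw Q 1 ≤ θ) :
    ∫⁻ p, ∏ t ∈ Finset.Ico j K,
      H (loopLetter P Q lam ρ G q e x0 x p t) (loopOutput P Q lam ρ G q e x0 p t)
      ∂((labelLaw Q 1).prod (channelLaw P)) ≤ θ ^ (K - j) := by
  refine lintegral_prod_Ico_le (labelRowLaw Q 1) (channelMapLaw P)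
    (f := fun t p => H (loopLetter P Q lam ρ G q e x0 x p t)
      (loopOutput P Q lam ρ G q e x0 p t)) 
    (measurable_loopWeight P Q lam ρ G q e x0 hρ x H) ?_ hjK ?_
  · intro i t hit p y w
    have h1 : ∀ k < i + 1, Function.update p.1 t y k = p.1 k := fun k hk =>
      Function.update_of_ne (by omega) _ _
    have h2 : ∀ k < i + 1, Function.update p.2 t w k = p.2 k := fun k hk =>
      Function.update_of_ne (by omega) _ _
    have hs := loopShift_congr P Q lam ρ G q e x0 hρ
      (p := (Function.update p.1 t y, Function.update p.2 t w)) (p' := p)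
      (fun k (hk : k < i) => h1 k (by omega)) (fun k hk => h2 k (by omega))
    have ho := loopOutput_congr P Q lam ρ G q e x0 hρ
      (p := (Function.update p.1 t y, Function.update p.2 t w)) (p' := p) h1 h2 i (by omega)
    simp only [loopLetter, hs, ho, h1 i (by omega)]
  · intro t ht p
    have hs := fun y w => loopShift_congr P Q lam ρ G q e x0 hρ
      (p := (Function.update p.1 t y, Function.update p.2 t w)) (p' := p) (t := t)
      (fun k hk => Function.update_of_ne hk.ne _ _) (fun k hk => Function.update_of_ne hk.ne _ _)
    simp only [loopLetter, loopOutput_eq P Q lam G q e x0 hρ, hs, Function.update_self]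
    exact hmean t ht _

end ClosedLoop

instance {A : Type u} [MeasurableSpace A] (Q : PMF A) (n : ℕ) :
    IsProbabilityMeasure (labelLaw Q n) := by unfold labelLaw; infer_instance

instance {A : Type u} {B : Type v} [Fintype A] [MeasurableSpace B] (P : DMC A B) :
    IsProbabilityMeasure (channelLaw P) := by unfold channelLaw; infer_instance

/-! ### Probability of decoding errors -/

section ErrorEvents

variable {A : Type u} {B : Type v} [Fintype A] [Fintype B]
  [MeasurableSpace A] [MeasurableSingletonClass A] [MeasurableSpace B] [MeasurableSingletonClass B]
  (P : DMC A B) (Q : PMF A) (lam ρ G : ℝ) (q : ℕ) (e : ℕ → ℕ → ℝ) (x0 : ℝ)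

/-- The likelihood score over the window `[j, K)` of the initial condition `x`. -/
noncomputable def loopScore (x : ℝ) (p : Labels A 1 × (ℕ → A → B)) (j K : ℕ) : ℝ :=
  ∏ t ∈ Finset.Ico j K, likelihoodRatio P Q (loopLetter P Q lam ρ G q e x0 x p t)
    (loopOutput P Q lam ρ G q e x0 p t)

/-- The true initial condition fails the test on a window with exponentially small probability. -/
theorem measure_loopScore_true_lt (hρ : 0 < ρ) (hG : 0 < G) {s : ℝ} (hs : 0 < s) {j K : ℕ}
    (hjK : j ≤ K) :
    ((labelLaw Q 1).prod (channelLaw P))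
      {p | loopScore P Q lam ρ G q e x0 x0 p j K < G ^ (K - j)} ≤
      (∑ a, Q a * ∑ b, P a b * chernoffWeight P Q G s a b) ^ (K - j) := by
  have hle := lintegral_prod_loop_le P Q lam ρ G q e x0 hρ x0 (chernoffWeight P Q G s) hjK
    (fun t _ c => (lintegral_transmitted P Q _ (chernoffWeight P Q G s)).le)
  have hm : Measurable fun p => ∏ t ∈ Finset.Ico j K, chernoffWeight P Q G s
      (loopLetter P Q lam ρ G q e x0 x0 p t) (loopOutput P Q lam ρ G q e x0 p t) :=
    Finset.measurable_fun_prod _ fun t _ => measurable_loopWeight P Q lam ρ G q e x0 hρ x0 _ t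
  refine (measure_mono fun p hp => ?_).trans ((meas_ge_le_lintegral_div hm.aemeasurable
    one_ne_zero ENNReal.one_ne_top).trans (by rw [div_one]; exact hle))
  exact one_le_prod_chernoffWeight P Q hG hs _ _ _ (by rw [Nat.card_Ico]; exact hp)

/-- An initial condition whose cells differ from the true ones from time `j` on passes the test on
`[j, K)` with probability at most `(1 / G) ^ (K - j)`. -/
theorem measure_loopScore_false_ge (hρ : 0 < ρ) (hμ : 1 ≤ lam / ρ) (hG : 0 < G) {x : ℝ}
    {j K : ℕ} (hjK : j ≤ K) (hx : 1 ≤ (lam / ρ) ^ j * |x0 - x|) :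
    ((labelLaw Q 1).prod (channelLaw P))
      {p | G ^ (K - j) ≤ loopScore P Q lam ρ G q e x0 x p j K} ≤
      ENNReal.ofReal ((1 / G) ^ (K - j)) := by
  let H : A → B → ENNReal := fun a b => ENNReal.ofReal (likelihoodRatio P Q a b)
  have hle := lintegral_prod_loop_le P Q lam ρ G q e x0 hρ x H (θ := 1) hjK (fun t ht c => by
    have hne : cell (lam / ρ) t x0 ≠ cell (lam / ρ) t x := by
      refine cell_ne_of_one_le (hx.trans ?_)
      gcongr
    rw [lintegral_untransmitted P Q (fun h => hne (sub_left_injective h)) H]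
    exact sum_likelihoodRatio_le_one P Q)
  rw [one_pow] at hle
  have hm : Measurable fun p => ∏ t ∈ Finset.Ico j K, H
      (loopLetter P Q lam ρ G q e x0 x p t) (loopOutput P Q lam ρ G q e x0 p t) :=
    Finset.measurable_fun_prod _ fun t _ => measurable_loopWeight P Q lam ρ G q e x0 hρ x _ t
  have hGd : 0 < G ^ (K - j) := by positivity
  refine (measure_mono fun p hp => ?_).trans ((meas_ge_le_lintegral_div hm.aemeasurable
    (ε := ENNReal.ofReal (G ^ (K - j))) (ENNReal.ofReal_pos.2 hGd).ne'
    ENNReal.ofReal_ne_top).trans ?_)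
  · have : ENNReal.ofReal (G ^ (K - j)) ≤
        ENNReal.ofReal (loopScore P Q lam ρ G q e x0 x p j K) := ENNReal.ofReal_le_ofReal hp
    rwa [loopScore, ENNReal.ofReal_prod_of_nonneg fun _ _ => likelihoodRatio_nonneg P Q _ _]
      at this
  · rw [one_div, inv_pow, ENNReal.ofReal_inv_of_pos hGd, ← one_div]
    gcongr

/-- Number of values of the sum of the cell indices over `[j, K)`, for initial conditions within
`Λ / μ ^ j` of `x0`. -/
theorem card_sum_cell_le {μ Λ : ℝ} (hμ : 1 ≤ μ) (hΛ : 0 ≤ Λ) {j K : ℕ} (hjK : j ≤ K) :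
    ((Finset.Icc (∑ t ∈ Finset.Ico j K, cell μ t (x0 - Λ / μ ^ j))
      (∑ t ∈ Finset.Ico j K, cell μ t (x0 + Λ / μ ^ j))).card : ℝ) ≤
      (2 * Λ + 2) * ((K - j : ℕ) + 1) * μ ^ (K - j) := by
  have hμ0 : 0 < μ := by linarith
  have hmono : ∑ t ∈ Finset.Ico j K, cell μ t (x0 - Λ / μ ^ j) ≤
      ∑ t ∈ Finset.Ico j K, cell μ t (x0 + Λ / μ ^ j) :=
    Finset.sum_le_sum fun t _ => cell_mono hμ0.le t (by
      have : 0 ≤ Λ / μ ^ j := by positivity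
      linarith)
  rw [Int.card_Icc, ← Int.cast_natCast, Int.toNat_of_nonneg (by omega), add_sub_right_comm,
    ← Finset.sum_sub_distrib]
  push_cast only [Int.cast_add, Int.cast_one, Int.cast_sum]
  have hterm : ∀ t ∈ Finset.Ico j K,
      ((cell μ t (x0 + Λ / μ ^ j) - cell μ t (x0 - Λ / μ ^ j) : ℤ) : ℝ) ≤
        (2 * Λ + 1) * μ ^ (K - j) := by
    intro t ht
    obtain ⟨h1, h2⟩ := Finset.mem_Ico.1 ht
    refine (cell_sub_cell_le _ _ _ _).trans ?_
    have e1 : μ ^ t * (x0 + Λ / μ ^ j - (x0 - Λ / μ ^ j)) = 2 * Λ * μ ^ (t - j) := by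
      rw [← Nat.sub_add_cancel h1, pow_add, Nat.add_sub_cancel]
      field_simp
      ring
    have e2 : μ ^ (t - j) ≤ μ ^ (K - j) := pow_le_pow_right₀ hμ (by omega)
    have e3 : 1 ≤ μ ^ (K - j) := one_le_pow₀ hμ
    rw [e1]
    nlinarith
  have hsum := Finset.sum_le_card_nsmul _ _ _ hterm
  rw [Nat.card_Ico, nsmul_eq_mul] at hsum
  have e3 : 1 ≤ μ ^ (K - j) := one_le_pow₀ hμ
  have e4 : 0 ≤ ((K - j : ℕ) : ℝ) * μ ^ (K - j) := by positivity
  have e5 : 0 ≤ Λ * μ ^ (K - j) := by positivity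
  nlinarith

/-- Union bound over the initial conditions that separate from the true one near time `j`: there
are essentially `μ ^ (K - j)` cell sequences on `[j, K)` to consider. -/
theorem measure_exists_false_le (hρ : 0 < ρ) (hμ : 1 ≤ lam / ρ) (hG : 0 < G) {Λ : ℝ}
    (hΛ : 0 ≤ Λ) {j K : ℕ} (hjK : j ≤ K) :
    ((labelLaw Q 1).prod (channelLaw P))
      {p | ∃ x, 1 ≤ (lam / ρ) ^ j * |x0 - x| ∧ (lam / ρ) ^ j * |x0 - x| ≤ Λ ∧
        G ^ (K - j) ≤ loopScore P Q lam ρ G q e x0 x p j K} ≤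
      ENNReal.ofReal ((2 * Λ + 2) * ((K - j : ℕ) + 1) * (lam / ρ / G) ^ (K - j)) := by
  set μ := lam / ρ with hμdef
  have hμ0 : 0 < μ := by linarith
  let S : ℝ → ℤ := fun x => ∑ t ∈ Finset.Ico j K, cell μ t x
  let I := Finset.Icc (S (x0 - Λ / μ ^ j)) (S (x0 + Λ / μ ^ j))
  have hS : Monotone S := fun x y hxy =>
    Finset.sum_le_sum fun t _ => cell_mono hμ0.le t hxy
  calc _ ≤ ((labelLaw Q 1).prod (channelLaw P)) (⋃ σ ∈ I, {p | ∃ x, S x = σ ∧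
        1 ≤ μ ^ j * |x0 - x| ∧ G ^ (K - j) ≤ loopScore P Q lam ρ G q e x0 x p j K}) := by
        refine measure_mono ?_
        rintro p ⟨x, h1, h2, h3⟩
        simp only [Set.mem_iUnion]
        refine ⟨S x, ?_, x, rfl, h1, h3⟩
        have : |x0 - x| ≤ Λ / μ ^ j := by
          rw [le_div_iff₀ (by positivity), mul_comm]; exact h2
        rw [abs_le] at this
        exact Finset.mem_Icc.2 ⟨hS (by linarith), hS (by linarith)⟩
    _ ≤ ∑ σ ∈ I, ENNReal.ofReal ((1 / G) ^ (K - j)) := by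
        refine (measure_biUnion_finset_le _ _).trans (Finset.sum_le_sum fun σ _ => ?_)
        by_cases hex : ∃ x, S x = σ ∧ 1 ≤ μ ^ j * |x0 - x|
        · obtain ⟨x, hxσ, hx⟩ := hex
          refine (measure_mono ?_).trans
            (measure_loopScore_false_ge P Q lam ρ G q e x0 hρ hμ hG hjK hx)
          rintro p ⟨x', hx'σ, -, h⟩
          have hc := cell_eq_of_sum_eq hμ0.le _ (hxσ.trans hx'σ.symm)
          have : loopScore P Q lam ρ G q e x0 x p j K =
              loopScore P Q lam ρ G q e x0 x' p j K :=
            Finset.prod_congr rfl fun t ht => by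
              rw [loopLetter, loopLetter, ← hμdef, hc t ht]
          rw [Set.mem_ofPred_eq, this]
          exact h
        · have : {p | ∃ x, S x = σ ∧ 1 ≤ μ ^ j * |x0 - x| ∧
              G ^ (K - j) ≤ loopScore P Q lam ρ G q e x0 x p j K} = ∅ :=
            Set.eq_empty_of_forall_notMem fun p ⟨x, h1, h2, _⟩ => hex ⟨x, h1, h2⟩
          rw [this, measure_empty]
          exact zero_le
    _ ≤ _ := by
        rw [Finset.sum_const, nsmul_eq_mul, ← ENNReal.ofReal_natCast,
          ← ENNReal.ofReal_mul (by positivity)]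
        refine ENNReal.ofReal_le_ofReal ?_
        calc (I.card : ℝ) * (1 / G) ^ (K - j) ≤
            (2 * Λ + 2) * ((K - j : ℕ) + 1) * μ ^ (K - j) * (1 / G) ^ (K - j) := by
              gcongr
              exact card_sum_cell_le x0 hμ hΛ hjK
          _ = _ := by rw [mul_assoc, ← mul_pow, mul_one_div]

/-- The decoding error event for the window of length `d` that ends at time `K`: the true initial
condition fails the test, or one that separates from it near time `K - d` passes.  Separations
at later times do not matter for this window. -/
def windowError (Λ : ℝ) (d K : ℕ) : Set (Labels A 1 × (ℕ → A → B)) :=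
  {p | loopScore P Q lam ρ G q e x0 x0 p (K - d) K < G ^ d ∨
    ∃ x, 1 ≤ (lam / ρ) ^ (K - d) * |x0 - x| ∧ (lam / ρ) ^ (K - d) * |x0 - x| ≤ Λ ∧
      G ^ d ≤ loopScore P Q lam ρ G q e x0 x p (K - d) K}

/-- Almost surely, from some time on no tested window has a decoding error.  A window of length `d`
is tested at no more than `q * d + 1` times, and its error probability is exponentially small
in `d`. -/
theorem ae_eventually_no_windowError (hρ : 0 < ρ) (hμ : 1 ≤ lam / ρ) (hμG : lam / ρ < G)
    (hGI : Real.logb 2 G < mutualInformation P Q) {Λ : ℝ} (hΛ : 0 ≤ Λ) :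
    ∀ᵐ p ∂((labelLaw Q 1).prod (channelLaw P)), ∀ᶠ K in atTop,
      ∀ d, d ≤ K → K ≤ q * d → p ∉ windowError P Q lam ρ G q e x0 Λ d K := by
  have hG : 0 < G := by linarith
  obtain ⟨s, hs, hθ⟩ := exists_chernoffWeight_mean_lt_one P Q hG hGI
  set θ := ∑ a, Q a * ∑ b, P a b * chernoffWeight P Q G s a b
  set μ := lam / ρ
  have hθtop : θ ≠ ⊤ := (hθ.trans ENNReal.one_lt_top).ne
  have hθ1 : θ.toReal < 1 := by
    rw [← ENNReal.toReal_one]; exact (ENNReal.toReal_lt_toReal hθtop ENNReal.one_ne_top).2 hθ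
  let a : ℕ → ℝ := fun d => θ.toReal ^ d + (2 * Λ + 2) * ((d : ℕ) + 1) * (μ / G) ^ d
  have ha0 : ∀ d, 0 ≤ a d := fun d => by positivity
  have ha : ∀ d K, d ≤ K → ((labelLaw Q 1).prod (channelLaw P))
      (windowError P Q lam ρ G q e x0 Λ d K) ≤ ENNReal.ofReal (a d) := by
    intro d K hdK
    have hd : K - (K - d) = d := Nat.sub_sub_self hdK
    have h1 := measure_loopScore_true_lt P Q lam ρ G q e x0 hρ hG hs (Nat.sub_le K d)
    have h2 := measure_exists_false_le P Q lam ρ G q e x0 hρ hμ hG hΛ (Nat.sub_le K d)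
    rw [hd] at h1 h2
    rw [ENNReal.ofReal_add (by positivity) (by positivity),
      ENNReal.ofReal_pow ENNReal.toReal_nonneg, ENNReal.ofReal_toReal hθtop]
    exact (measure_union_le _ _).trans (add_le_add h1 h2)
  have hsum : Summable fun d : ℕ => ((q * d + 1 : ℕ) : ℝ) * a d := by
    have hr : ‖μ / G‖ < 1 := by
      rw [Real.norm_of_nonneg (by positivity), div_lt_one hG]; exact hμG
    have hr' : ‖θ.toReal‖ < 1 := by rwa [Real.norm_of_nonneg ENNReal.toReal_nonneg]
    have t0 := summable_pow_mul_geometric_of_norm_lt_one 0 hr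
    have t1 := summable_pow_mul_geometric_of_norm_lt_one 1 hr
    have t2 := summable_pow_mul_geometric_of_norm_lt_one 2 hr
    have u0 := summable_pow_mul_geometric_of_norm_lt_one 0 hr'
    have u1 := summable_pow_mul_geometric_of_norm_lt_one 1 hr'
    refine ((((u1.mul_left (q : ℝ)).add u0).add (t2.mul_left (q * (2 * Λ + 2)))).add
      ((t1.mul_left ((q + 1) * (2 * Λ + 2))).add (t0.mul_left (2 * Λ + 2)))).congr fun d => ?_
    simp only [a]
    push_cast
    ring
  have key : ∑' K : ℕ, ((labelLaw Q 1).prod (channelLaw P))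
      (⋃ d : ℕ, ⋃ (_ : d ≤ K ∧ K ≤ q * d), windowError P Q lam ρ G q e x0 Λ d K) ≠ ⊤ := by
    refine ne_top_of_le_ne_top hsum.tsum_ofReal_ne_top ?_
    -- Exchanging the sums: a given `d` occurs only for the `q * d + 1` values `K ≤ q * d`.
    calc _ ≤ ∑' K : ℕ, ∑' d : ℕ, if K ≤ q * d then ENNReal.ofReal (a d) else 0 := by
          refine ENNReal.tsum_le_tsum fun K => (measure_iUnion_le _).trans
            (ENNReal.tsum_le_tsum fun d => ?_)
          by_cases h : d ≤ K ∧ K ≤ q * d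
          · simp only [h, and_self, Set.iUnion_true, if_true]
            exact ha d K h.1
          · simp [h]
      _ = ∑' d : ℕ, ∑' K : ℕ, if K ≤ q * d then ENNReal.ofReal (a d) else 0 :=
          ENNReal.tsum_comm
      _ ≤ _ := by
          refine ENNReal.tsum_le_tsum fun d => ?_
          rw [tsum_eq_sum (s := Finset.range (q * d + 1)) fun K hK => by
            rw [if_neg]; simpa [Nat.lt_succ_iff] using hK]
          calc _ ≤ ∑ K ∈ Finset.range (q * d + 1), ENNReal.ofReal (a d) :=
                Finset.sum_le_sum fun K _ => by split_ifs <;> simp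
            _ = _ := by
                rw [Finset.sum_const, Finset.card_range, nsmul_eq_mul,
                  ENNReal.ofReal_mul (by positivity), ENNReal.ofReal_natCast]
  filter_upwards [ae_eventually_notMem key] with p hp
  filter_upwards [hp] with K hK d hd1 hd2 hmem
  exact hK (Set.mem_iUnion.2 ⟨d, Set.mem_iUnion.2 ⟨⟨hd1, hd2⟩, hmem⟩⟩)

end ErrorEvents

/-! ### Convergence of the state -/

section Stability

variable {A : Type u} {B : Type v} [Fintype A] [Fintype B]
  [MeasurableSpace A] [MeasurableSingletonClass A] [MeasurableSpace B] [MeasurableSingletonClass B]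
  (P : DMC A B) (Q : PMF A) (lam ρ G : ℝ) (q : ℕ) (e : ℕ → ℕ → ℝ) (x0 : ℝ)

/-- Without decoding errors on the tested windows, the state is of the order of
`ρ ^ K * μ ^ (K / q)`. -/
theorem abs_state_le_of_no_windowError (hρ : 0 < ρ) (hμ : 1 ≤ lam / ρ) (hq : 0 < q) {r Λ : ℝ}
    (hΛμ : lam / ρ ≤ Λ) (hΛr : 2 * r ≤ Λ) (hx0 : |x0| ≤ r) (he1 : ∀ K i, |e K i| ≤ r)
    (he2 : ∀ K x, |x| ≤ r → ∃ i, ∀ t < K, cell (lam / ρ) t (e K i) = cell (lam / ρ) t x)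
    {p : Labels A 1 × (ℕ → A → B)} {K : ℕ} (hK : 0 < K)
    (hp : ∀ d, d ≤ K → K ≤ q * d → p ∉ windowError P Q lam ρ G q e x0 Λ d K) :
    |(latticeScheme P Q lam ρ G q e).state lam (fun _ => 0) x0 p.1 p.2 K| ≤
      ρ ^ K * ((lam / ρ) ^ (K / q + 1) + 3 / 2) := by
  set μ := lam / ρ with hμdef
  have hμ0 : 0 < μ := by linarith
  let acc : ℝ → Prop := Accepts P Q μ G q p.1 (loopOutput P Q lam ρ G q e x0 p)
    (loopShift P Q lam ρ G q e x0 p) K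
  have hacc0 : acc x0 := by
    intro j hj hjq
    by_contra hlt
    refine hp (K - j) (Nat.sub_le _ _) hjq (Or.inl ?_)
    rw [Nat.sub_sub_self hj.le]
    exact not_le.1 hlt
  obtain ⟨i, hi⟩ := he2 K x0 hx0
  have hex : ∃ i, acc (e K i) := ⟨i, (accepts_congr P Q μ G q (fun _ _ => rfl) (fun _ _ => rfl)
    (fun _ _ => rfl) hi).2 hacc0⟩
  have hx := firstIndex_spec hex
  set x := e K (firstIndex fun i => acc (e K i)) with hxdef
  have hxr : |x| ≤ r := he1 _ _
  have hshift : loopShift P Q lam ρ G q e x0 p K = cell μ K x := by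
    rw [loopShift, shift_eq_decode, decode, if_neg hK.ne']
    rfl
  -- Induction on `j`: a first `j` at which this fails would have `x` just beyond `μ ^ (-j)` from
  -- `x0`, which is the second kind of window error.  The bound `2 * r ≤ Λ` covers `j = 0`.
  have hclose : ∀ j < K, K ≤ q * (K - j) → μ ^ j * |x0 - x| < 1 := by
    intro j
    induction j with
    | zero =>
      intro hj hjq
      by_contra hge
      refine hp (K - 0) (Nat.sub_le _ _) hjq (Or.inr ⟨x, ?_⟩)
      rw [Nat.sub_sub_self hj.le]
      refine ⟨not_lt.1 hge, ?_, hx 0 hj hjq⟩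
      have := abs_sub x0 x
      rw [pow_zero, one_mul]
      linarith
    | succ j ih =>
      intro hj hjq
      by_contra hge
      refine hp (K - (j + 1)) (Nat.sub_le _ _) hjq (Or.inr ⟨x, ?_⟩)
      rw [Nat.sub_sub_self hj.le]
      refine ⟨not_lt.1 hge, ?_, hx _ hj hjq⟩
      have := ih (by omega) (hjq.trans (Nat.mul_le_mul_left q (by omega)))
      rw [pow_succ]
      nlinarith
  have hKq : K ≤ q * (K / q + 1) := (Nat.lt_mul_div_succ K hq).le
  have hfar : μ ^ K * |x0 - x| ≤ μ ^ (K / q + 1) := by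
    have h1 := hclose (K - (K / q + 1)) (Nat.sub_lt hK (Nat.succ_pos _)) (by
      rcases le_total (K / q + 1) K with h | h
      · rwa [Nat.sub_sub_self h]
      · rw [Nat.sub_eq_zero_of_le h, Nat.sub_zero]
        exact Nat.le_mul_of_pos_left K hq)
    calc μ ^ K * |x0 - x| ≤ μ ^ ((K / q + 1) + (K - (K / q + 1))) * |x0 - x| := by
          gcongr
          omega
      _ = μ ^ (K / q + 1) * (μ ^ (K - (K / q + 1)) * |x0 - x|) := by rw [pow_add]; ring
      _ ≤ μ ^ (K / q + 1) * 1 := by gcongr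
      _ = _ := mul_one _
  have hst : lam ^ K * x0 - ρ ^ K * (cell μ K x : ℝ) =
      ρ ^ K * (μ ^ K * (x0 - x) + (μ ^ K * x - cell μ K x)) := by
    rw [hμdef, div_pow]
    field_simp
    ring
  rw [latticeScheme_state, hshift, hst, abs_mul, abs_of_pos (by positivity : 0 < ρ ^ K)]
  gcongr
  refine (abs_add_le _ _).trans (add_le_add ?_ (abs_sub_cell_le μ K x))
  rw [abs_mul, abs_of_pos (by positivity : 0 < μ ^ K)]
  exact hfar

theorem tendsto_pow_mul_pow_div {ρ μ : ℝ} (hρ : 0 < ρ) (hρ1 : ρ < 1) (hμ : 0 < μ) {q : ℕ}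
    (hq : 0 < q) (h : ρ ^ q * μ < 1) :
    Tendsto (fun K : ℕ => ρ ^ K * (μ ^ (K / q + 1) + 3 / 2)) atTop (𝓝 0) := by
  have h1 : Tendsto (fun K : ℕ => (ρ ^ q * μ) ^ (K / q) * μ + ρ ^ K * (3 / 2)) atTop (𝓝 0) := by
    have t1 := ((tendsto_pow_atTop_nhds_zero_of_lt_one (by positivity) h).comp
      (Nat.tendsto_div_const_atTop hq.ne')).mul_const μ
    have t2 := (tendsto_pow_atTop_nhds_zero_of_lt_one hρ.le hρ1).mul_const (3 / 2)
    simpa using t1.add t2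
  refine squeeze_zero (fun K => by positivity) (fun K => ?_) h1
  have h2 : ρ ^ K ≤ (ρ ^ q) ^ (K / q) := by
    rw [← pow_mul]
    exact pow_le_pow_of_le_one hρ.le hρ1.le (Nat.mul_div_le K q)
  rw [mul_add, mul_pow, pow_succ, ← mul_assoc]
  gcongr

theorem latticeScheme_stabilizes (hρ : 0 < ρ) (hρ1 : ρ < 1) (hμ : 1 ≤ lam / ρ)
    (hμG : lam / ρ < G) (hGI : Real.logb 2 G < mutualInformation P Q) (hq : 0 < q)
    (hqμ : ρ ^ q * (lam / ρ) < 1) {Om : ℝ} (he1 : ∀ K i, |e K i| ≤ Om / 2)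
    (he2 : ∀ K x, |x| ≤ Om / 2 → ∃ i, ∀ t < K, cell (lam / ρ) t (e K i) = cell (lam / ρ) t x) :
    (latticeScheme P Q lam ρ G q e).StabilizesAlmostSurely (labelLaw Q 1) P lam Om := by
  intro x0 hx0
  have hΛ : 0 ≤ max (lam / ρ) Om := le_max_of_le_left (by linarith)
  filter_upwards [ae_eventually_no_windowError P Q lam ρ G q e x0 hρ hμ hμG hGI hΛ] with p hp
  refine squeeze_zero_norm' ?_ (tendsto_pow_mul_pow_div hρ hρ1 (by linarith) hq hqμ)
  filter_upwards [hp, eventually_gt_atTop 0] with K hK hK0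
  exact abs_state_le_of_no_windowError P Q lam ρ G q e x0 hρ hμ hq (le_max_left _ _)
    (by rw [mul_div_cancel₀ _ two_ne_zero]; exact le_max_right _ _) hx0 he1 he2 hK0 hK

end Stability

end NoisyControl

theorem mainTheorem9 {A : Type u} {B : Type v} [Fintype A] [Fintype B]
    [MeasurableSpace A] [MeasurableSingletonClass A]
    [MeasurableSpace B] [MeasurableSingletonClass B]
    (P : DMC A B) (lam Om : ℝ) (hlam : 1 < lam) (hOm : 0 < Om)
    (hC : Real.logb 2 lam < capacity P) :
    (∃ (R : Type u) (_ : MeasurableSpace R) (ν : Measure R) (_ : IsProbabilityMeasure ν)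
        (S : Scheme A B R), S.StabilizesAlmostSurely ν P lam Om) ∧
    (∃ Q : PMF A, IsCapacityAchieving P Q) ∧
    (∀ Q : PMF A, IsCapacityAchieving P Q →
      ∃ (n : ℕ) (hn : 0 < n) (Δ₀ ρ : ℝ) (S : Scheme A B (Labels A n)),
        0 < Δ₀ ∧ 0 < ρ ∧ ρ < 1 ∧
        S.observer = latticeObserver n hn (fun t => Δ₀ * ρ ^ t) ∧
        S.StabilizesAlmostSurely (labelLaw Q n) P lam Om) := by
  have hA : Nonempty A := by
    -- Without inputs the capacity is a supremum over the empty set, which is `0`.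
    by_contra hA
    rw [not_nonempty_iff] at hA
    have hempty : IsEmpty (PMF A) := ⟨fun Q => by simpa using sum_toReal_pmf Q⟩
    have h0 : capacity P = 0 := Real.iSup_of_isEmpty _
    have := Real.logb_pos one_lt_two hlam
    linarith
  obtain ⟨Q₀, hQ₀⟩ := exists_isCapacityAchieving P
  have main : ∀ Q : PMF A, IsCapacityAchieving P Q →
      ∃ (n : ℕ) (hn : 0 < n) (Δ₀ ρ : ℝ) (S : Scheme A B (Labels A n)),
        0 < Δ₀ ∧ 0 < ρ ∧ ρ < 1 ∧
        S.observer = latticeObserver n hn (fun t => Δ₀ * ρ ^ t) ∧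
        S.StabilizesAlmostSurely (labelLaw Q n) P lam Om := by
    intro Q hQ
    have hlam0 : 0 < lam := by linarith
    have hI : lam < 2 ^ mutualInformation P Q := by
      rw [← Real.logb_lt_iff_lt_rpow one_lt_two hlam0, hQ]; exact hC
    -- The growth rate `μ` of the number of cells exceeds `lam`, and the threshold `G` lies
    -- between `μ` and the channel capacity.
    obtain ⟨μ, hμ1, hμ2⟩ := exists_between hI
    obtain ⟨G, hG1, hG2⟩ := exists_between hμ2
    have hμ0 : 0 < μ := by linarith
    have hρ : 0 < lam / μ := by positivity
    have hρ1 : lam / μ < 1 := (div_lt_one hμ0).2 hμ1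
    have hμeq : lam / (lam / μ) = μ := by field_simp
    obtain ⟨q, hq⟩ := exists_pow_lt_of_lt_one (inv_pos.2 hμ0) hρ1
    have hq0 : 0 < q := by
      rcases Nat.eq_zero_or_pos q with rfl | h
      · rw [pow_zero] at hq
        have := inv_lt_one_of_one_lt₀ (hlam.trans hμ1)
        linarith
      · exact h
    obtain ⟨e, he1, he2⟩ := exists_cell_representatives μ (r := Om / 2) (by positivity)
    refine ⟨1, one_pos, 2, lam / μ, latticeScheme P Q lam (lam / μ) G q e, two_pos, hρ, hρ1, rfl,
      latticeScheme_stabilizes P Q lam (lam / μ) G q e hρ hρ1 ?_ ?_ ?_ hq0 ?_ he1 ?_⟩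
    · rw [hμeq]; linarith
    · rwa [hμeq]
    · rw [Real.logb_lt_iff_lt_rpow one_lt_two (by linarith)]; exact hG2
    · rw [hμeq, ← lt_div_iff₀ hμ0, one_div]; exact hq
    · rw [hμeq]; exact he2
  obtain ⟨n, _, _, _, S, _, _, _, _, hS⟩ := main Q₀ hQ₀
  exact ⟨⟨Labels A n, inferInstance, labelLaw Q₀ n, inferInstance, S, hS⟩, ⟨Q₀, hQ₀⟩, main⟩
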